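/- Let $d\ge 1$. For $u:\mathbb Z^d\to\mathbb R$ let $\Delta u(x)=\sum_{i=1}^d\bigl(u(x+e_i)+u(x-e_i)-2u(x)\bigr)$. For every $p\in\mathbb R^d\setminus\{0\}$ there is exactly one $u:\mathbb Z^d\to\mathbb R$ with $\Delta u(x)=0$ whenever $p\cdot x>0$, $u(x)=0$ whenever $p\cdot x\le 0$, and $\sup_{p\cdot x>0}|u(x)-p\cdot x|<\infty$; put $H(p)=\Delta u(0)$ for this $u$. Let $\Lambda_p=\{x\in\mathbb Z^d: p\cdot x=0\}$, let $S(\theta)=\log\bigl(1-\tfrac1d\sum_{k=1}^d\cos\theta_k\bigr)$, which is integrable on $[-\pi,\pi]^d$, and let $\hat S(q)=(2\pi)^{-d}\int_{[-\pi,\pi]^d}e^{-iq\cdot\theta}S(\theta)\,d\theta$ for $q\in\mathbb Z^d$. Then for every $p\in\mathbb R^d\setminus\{0\}$, $$\lim_{\substack{q\to p\\ \Lambda_p\subseteq\Lambda_q}}H(q)=H(p)\qquad\text{and}\qquad \liminf_{\substack{q\to p\\ \Lambda_p\nsubseteq\Lambda_q}}H(q)>H(p),$$ where the lower limit is $+\infty$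 if no slope $q$ near $p$ satisfies $\Lambda_p\nsubseteq\Lambda_q$. Moreover, for $\mathcal H^{d-1}$-almost every unit vector $p\in\mathbb R^d$, $$H(p)^2=2d\,\exp(\hat S(0)).$$ Hence, for $p\in\mathbb R^d\setminus\{0\}$, $H$ is discontinuous at $p$ if and only if $p$ satisfies a nontrivial Diophantine relation, that is, $p\cdot x=0$ for some $x\in\mathbb Z^d\setminus\{0\}$. -/

import Mathlib

open MeasureTheory Filter Topology

namespace LatticeHamiltonian

noncomputable section

/-- The product `p · x` of a slope `p ∈ ℝ^d` with a lattice point `x ∈ ℤ^d`. -/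
def dot {d : ℕ} (p : EuclideanSpace ℝ (Fin d)) (x : Fin d → ℤ) : ℝ :=
  ∑ i, p i * (x i : ℝ)

/-- The discrete Laplacian `Δu(x) = ∑ i, (u(x + e_i) + u(x - e_i) - 2 u(x))` on `ℤ^d`. -/
def laplacian {d : ℕ} (u : (Fin d → ℤ) → ℝ) (x : Fin d → ℤ) : ℝ :=
  ∑ i : Fin d, (u (x + Pi.single i 1) + u (x - Pi.single i 1) - 2 * u x)

/-- `u : ℤ^d → ℝ` solves the half-space problem for the slope `p`. -/
structure IsHalfSpaceSolution {d : ℕ} (p : EuclideanSpace ℝ (Fin d))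
    (u : (Fin d → ℤ) → ℝ) : Prop where
  harmonic : ∀ x, 0 < dot p x → laplacian u x = 0
  zero : ∀ x, dot p x ≤ 0 → u x = 0
  bounded : ∃ C : ℝ, ∀ x, 0 < dot p x → |u x - dot p x| ≤ C

open Classical in
/-- The Hamiltonian: `H(p) = Δu(0)` for the solution `u` of the half-space problem for `p`. -/
def H {d : ℕ} (p : EuclideanSpace ℝ (Fin d)) : ℝ :=
  if h : ∃ u, IsHalfSpaceSolution p u then laplacian h.choose 0 else 0

/-- The lattice `Λ_p` of Diophantine relations satisfied by `p`. -/
def Lam {d : ℕ} (p : EuclideanSpace ℝ (Fin d)) : Set (Fin d → ℤ) :=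
  {x | dot p x = 0}

/-- `S(θ) = log (1 - (1/d) ∑ cos θ_k)`, a function on `ℝ^d` with period `2π` in every variable. -/
def S {d : ℕ} (θ : Fin d → ℝ) : ℝ :=
  Real.log (1 - (1 / (d : ℝ)) * ∑ k, Real.cos (θ k))

/-- The fundamental cell `[-π, π]^d`. -/
def cell (d : ℕ) : Set (Fin d → ℝ) :=
  Set.Icc (fun _ => -Real.pi) (fun _ => Real.pi)

/-- The Fourier coefficients `Ŝ(q) = (2π)^(-d) ∫_{[-π,π]^d} e^{-i q·θ} S(θ) dθ`. -/
def Shat {d : ℕ} (q : Fin d → ℤ) : ℂ :=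
  ((2 * (Real.pi : ℂ)) ^ d)⁻¹ *
    ∫ θ in cell d, Complex.exp (-Complex.I * ∑ k, (q k : ℂ) * (θ k : ℂ)) * (S θ : ℂ)

end

end LatticeHamiltonian

namespace LatticeHamiltonian

noncomputable section

/-! ### The group algebra of the line -/

/-! The solution has the form `u x = g (dot p x)`, where `g` vanishes on `(-∞, 0]`, stays at bounded
distance from the identity on `[0, ∞)`, and is harmonic on `(0, ∞)` for the walk on the line with
steps `± p i`, each of probability `1/(2d)`. Monotone iteration produces `g`; a maximum principle
gives uniqueness. Hence `H p = 2 d m`, with `m` the mean of `g` after one step from `0`.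

The Wiener–Hopf factorization of this symmetric walk (`IsSymmStep.factorization`) computes `m`. Its
second moment, in the limit `z ↑ 1`, reads `2 m² = σ² exp(-A(p))` (`IsSymmStep.sq_mean_harmonic`),
where `σ² = ‖p‖²/d` and `A(p) = ∑_{n ≥ 1} P(p · X_n = 0)/n` for the simple random walk `X` on `ℤ^d`.
So `H p = ‖p‖ √(2d) exp(-A(p)/2)` (`H_eq_exp`).

All discontinuity sits in `A(p)`, the sum over `n ≥ 1` and `x ∈ Λ_p` of `P(X_n = x)/n`. The terms in
`n` are dominated uniformly in `p` (`returnProb_le`). For fixed `n` only finitely many `x` matter,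
so no new relation among them appears near `p`: each term is locally constant along slopes that keep
`Λ_p`, and drops by `P(X_n = x)` when the relation `x` is lost. The walk reaches every `x`, so a
lost relation lowers `A` by a definite amount and raises `H`. Finite generation of `Λ_p` makes the
gap uniform.

If `Λ_p = 0`, then `A(p) = ∑ P(X_n = 0)/n`. Since `P(X_n = 0)` is the mean over the cell of `φ^n`,
with `φ = (1/d) ∑ cos θ_k`, and `∑ φ^n/n = -log(1 - φ)`, this equals `-Ŝ(0)`. The other unit vectors
lie on countably many null subspheres. -/

/-- Finitely supported signed measures on the line, with convolution. -/
abbrev LineAlgebra := AddMonoidAlgebra ℝ ℝ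

/-- Integration of a function against a finitely supported measure. -/
def pairing (g : ℝ → ℝ) : LineAlgebra →ₗ[ℝ] ℝ :=
  (Finsupp.linearCombination ℝ g).comp (AddMonoidAlgebra.coeffLinearEquiv ℝ).toLinearMap

lemma pairing_apply (g : ℝ → ℝ) (f : LineAlgebra) :
    pairing g f = ∑ t ∈ f.coeff.support, f.coeff t * g t := by
  simp [pairing, Finsupp.linearCombination_apply, Finsupp.sum]

@[simp] lemma pairing_single (g : ℝ → ℝ) (t c : ℝ) :
    pairing g (AddMonoidAlgebra.single t c) = c * g t := by
  simp [pairing]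

lemma pairing_congr {g g' : ℝ → ℝ} {f : LineAlgebra}
    (h : ∀ t, f.coeff t ≠ 0 → g t = g' t) : pairing g f = pairing g' f := by
  rw [pairing_apply, pairing_apply]
  exact Finset.sum_congr rfl fun t ht => by rw [h t (Finsupp.mem_support_iff.1 ht)]

lemma pairing_single_mul (g : ℝ → ℝ) (s c : ℝ) (f : LineAlgebra) :
    pairing g (AddMonoidAlgebra.single s c * f) = c * pairing (fun t => g (s + t)) f := by
  induction f using AddMonoidAlgebra.induction_linear with
  | zero => simp
  | add f g hf hg => simp only [mul_add, map_add, hf, hg]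
  | single t b => simp [AddMonoidAlgebra.single_mul_single, mul_assoc]

/-- Total mass. -/
abbrev mass : LineAlgebra →ₗ[ℝ] ℝ := pairing fun _ => 1

/-- First moment. -/
abbrev moment1 : LineAlgebra →ₗ[ℝ] ℝ := pairing fun t => t

/-- Second moment. -/
abbrev moment2 : LineAlgebra →ₗ[ℝ] ℝ := pairing fun t => t ^ 2

/-- The mass at the origin. -/
def atZero : LineAlgebra →ₗ[ℝ] ℝ := pairing (Pi.single 0 1)

lemma atZero_apply (f : LineAlgebra) : atZero f = f.coeff 0 := by
  rw [atZero, pairing_apply, Finset.sum_eq_single 0]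
  · simp
  · intro b _ hb
    simp [hb]
  · intro h
    simp [Finsupp.notMem_support_iff.1 h]

lemma mass_mul (f g : LineAlgebra) : mass (f * g) = mass f * mass g := by
  induction f using AddMonoidAlgebra.induction_linear with
  | zero => simp
  | add f g hf hg => simp only [add_mul, map_add, hf, hg]
  | single t b => simp [pairing_single_mul]

lemma moment1_mul (f g : LineAlgebra) :
    moment1 (f * g) = moment1 f * mass g + mass f * moment1 g := by
  induction f using AddMonoidAlgebra.induction_linear with
  | zero => simp
  | add f g hf hg => simp only [add_mul, map_add, hf, hg]; ring
  | single t b =>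
    rw [pairing_single_mul]
    have : pairing (fun s => t + s) g = t * mass g + moment1 g := by
      simp only [pairing_apply, Finset.mul_sum, ← Finset.sum_add_distrib]
      exact Finset.sum_congr rfl fun s _ => by ring
    rw [this]
    simp only [pairing_single]
    ring

lemma moment2_mul (f g : LineAlgebra) :
    moment2 (f * g) = moment2 f * mass g + 2 * moment1 f * moment1 g + mass f * moment2 g := by
  induction f using AddMonoidAlgebra.induction_linear with
  | zero => simp
  | add f g hf hg => simp only [add_mul, map_add, hf, hg]; ring
  | single t b =>
    rw [pairing_single_mul]
    have : pairing (fun s => (t + s) ^ 2) g = t ^ 2 * mass g + 2 * t * moment1 g + moment2 g := by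
      simp only [pairing_apply, Finset.mul_sum, ← Finset.sum_add_distrib]
      exact Finset.sum_congr rfl fun s _ => by ring
    rw [this]
    simp only [pairing_single]
    ring

/-- `f` vanishes outside `s`. -/
def SuppIn (s : Set ℝ) (f : LineAlgebra) : Prop := ∀ t, f.coeff t ≠ 0 → t ∈ s

/-! ### Supports, half-lines, reflection and positivity. -/

lemma SuppIn.mono {s s' : Set ℝ} {f : LineAlgebra} (h : SuppIn s f) (hs : s ⊆ s') : SuppIn s' f :=
  fun t ht => hs (h t ht)

lemma SuppIn.zero (s : Set ℝ) : SuppIn s 0 := fun t ht => absurd (by simp) ht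

lemma SuppIn.one {s : Set ℝ} (h : (0 : ℝ) ∈ s) : SuppIn s 1 := by
  intro t ht
  rw [AddMonoidAlgebra.one_def, AddMonoidAlgebra.coeff_single] at ht
  by_cases h0 : t = 0
  · rwa [h0]
  · exact absurd (by simp [Ne.symm h0]) ht

lemma SuppIn.add {s : Set ℝ} {f g : LineAlgebra} (hf : SuppIn s f) (hg : SuppIn s g) :
    SuppIn s (f + g) := by
  intro t ht
  by_contra hts
  refine ht ?_
  have h1 : f.coeff t = 0 := by by_contra h; exact hts (hf t h)
  have h2 : g.coeff t = 0 := by by_contra h; exact hts (hg t h)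
  simp [h1, h2]

lemma SuppIn.smul {s : Set ℝ} {f : LineAlgebra} (c : ℝ) (hf : SuppIn s f) :
    SuppIn s (c • f) := by
  intro t ht
  refine hf t fun h => ht ?_
  simp [h]

lemma SuppIn.sum {s : Set ℝ} {ι : Type*} {I : Finset ι} {f : ι → LineAlgebra}
    (hf : ∀ i ∈ I, SuppIn s (f i)) : SuppIn s (∑ i ∈ I, f i) := by
  classical
  induction I using Finset.induction_on with
  | empty => simpa using SuppIn.zero s
  | insert a I ha ih =>
    rw [Finset.sum_insert ha]
    exact (hf a (by simp)).add (ih fun i hi => hf i (by simp [hi]))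

lemma SuppIn.mul {s s' r : Set ℝ} {f g : LineAlgebra} (hf : SuppIn s f) (hg : SuppIn s' g)
    (h : ∀ a ∈ s, ∀ b ∈ s', a + b ∈ r) : SuppIn r (f * g) := by
  classical
  intro t ht
  have := AddMonoidAlgebra.support_coeff_mul_subset f g (Finsupp.mem_support_iff.2 ht)
  obtain ⟨a, ha, b, hb, rfl⟩ := Finset.mem_add.1 this
  exact h a (hf a (Finsupp.mem_support_iff.1 ha)) b (hg b (Finsupp.mem_support_iff.1 hb))

/-- Restriction of a measure to the positive half-line. -/
def posPart : LineAlgebra →ₗ[ℝ] LineAlgebra where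
  toFun f := .ofCoeff (f.coeff.filter (0 < ·))
  map_add' f g := by
    ext t
    by_cases h : 0 < t <;> simp [h]
  map_smul' c f := by
    ext t
    by_cases h : 0 < t <;> simp [h]

lemma posPart_coeff (f : LineAlgebra) (t : ℝ) :
    (posPart f).coeff t = if 0 < t then f.coeff t else 0 := by
  simp [posPart, Finsupp.filter_apply]

/-- Reflection of a measure at the origin. -/
def reflect : LineAlgebra →+* LineAlgebra :=
  AddMonoidAlgebra.mapDomainRingHom ℝ (-AddMonoidHom.id ℝ)

@[simp] lemma reflect_single (t c : ℝ) :
    reflect (AddMonoidAlgebra.single t c) = AddMonoidAlgebra.single (-t) c := by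
  simp [reflect]

lemma reflect_reflect (f : LineAlgebra) : reflect (reflect f) = f := by
  induction f using AddMonoidAlgebra.induction_linear with
  | zero => simp
  | add f g hf hg => simp only [map_add, hf, hg]
  | single t b => simp

lemma pairing_reflect (g : ℝ → ℝ) (f : LineAlgebra) :
    pairing g (reflect f) = pairing (fun t => g (-t)) f := by
  induction f using AddMonoidAlgebra.induction_linear with
  | zero => simp
  | add f g hf hg => simp only [map_add, hf, hg]
  | single t b => simp

lemma reflect_coeff (f : LineAlgebra) (t : ℝ) : (reflect f).coeff t = f.coeff (-t) := by
  induction f using AddMonoidAlgebra.induction_linear with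
  | zero => simp
  | add f g hf hg => simp [hf, hg]
  | single s b => simp [Finsupp.single_apply, neg_eq_iff_eq_neg]

lemma SuppIn.reflect {s s' : Set ℝ} {f : LineAlgebra} (hf : SuppIn s f)
    (h : ∀ a ∈ s, -a ∈ s') : SuppIn s' (reflect f) := by
  intro t ht
  rw [reflect_coeff] at ht
  simpa using h _ (hf _ ht)

/-- All coefficients are nonnegative. -/
def NonnegCoeff (f : LineAlgebra) : Prop := ∀ t, 0 ≤ f.coeff t

lemma NonnegCoeff.pairing_nonneg {f : LineAlgebra} (hf : NonnegCoeff f) {g : ℝ → ℝ}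
    (hg : ∀ t, f.coeff t ≠ 0 → 0 ≤ g t) : 0 ≤ pairing g f := by
  rw [pairing_apply]
  exact Finset.sum_nonneg fun t ht => mul_nonneg (hf t) (hg t (Finsupp.mem_support_iff.1 ht))

lemma NonnegCoeff.mul {f g : LineAlgebra} (hf : NonnegCoeff f) (hg : NonnegCoeff g) :
    NonnegCoeff (f * g) := by
  classical
  intro t
  rw [AddMonoidAlgebra.coeff_mul]
  refine Finset.sum_nonneg fun a _ => Finset.sum_nonneg fun b _ => ?_
  dsimp only
  split_ifs
  · exact mul_nonneg (hf a) (hg b)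
  · exact le_rfl

lemma NonnegCoeff.one : NonnegCoeff 1 := by
  intro t
  rw [AddMonoidAlgebra.one_def, AddMonoidAlgebra.coeff_single, Finsupp.single_apply]
  split_ifs <;> norm_num

lemma NonnegCoeff.pow {f : LineAlgebra} (hf : NonnegCoeff f) (n : ℕ) : NonnegCoeff (f ^ n) := by
  induction n with
  | zero => simpa using NonnegCoeff.one
  | succ n ih => rw [pow_succ]; exact ih.mul hf

lemma NonnegCoeff.abs_pairing_le {f : LineAlgebra} (hf : NonnegCoeff f) {g : ℝ → ℝ} {C : ℝ}
    (hg : ∀ t, f.coeff t ≠ 0 → |g t| ≤ C) : |pairing g f| ≤ C * mass f := by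
  rw [pairing_apply, pairing_apply, Finset.mul_sum]
  refine (Finset.abs_sum_le_sum_abs _ _).trans (Finset.sum_le_sum fun t ht => ?_)
  rw [abs_mul, abs_of_nonneg (hf t), mul_one, mul_comm]
  exact mul_le_mul_of_nonneg_right (hg t (Finsupp.mem_support_iff.1 ht)) (hf t)

lemma mass_one : mass 1 = 1 := by simp [AddMonoidAlgebra.one_def]

lemma mass_pow (f : LineAlgebra) (n : ℕ) : mass (f ^ n) = mass f ^ n := by
  induction n with
  | zero => simp [mass_one]
  | succ n ih => rw [pow_succ, mass_mul, ih, pow_succ]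

/-! ### Power series over the group algebra -/

open PowerSeries

/-- Apply a linear functional to all coefficients of a power series. -/
def mapSeries (L : LineAlgebra →ₗ[ℝ] ℝ) (F : PowerSeries LineAlgebra) : PowerSeries ℝ :=
  PowerSeries.mk fun n => L (coeff n F)

@[simp] lemma coeff_mapSeries (L : LineAlgebra →ₗ[ℝ] ℝ) (F : PowerSeries LineAlgebra) (n : ℕ) :
    coeff n (mapSeries L F) = L (coeff n F) := by simp [mapSeries]

@[simp] lemma constantCoeff_mapSeries (L : LineAlgebra →ₗ[ℝ] ℝ) (F : PowerSeries LineAlgebra) :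
    constantCoeff (mapSeries L F) = L (constantCoeff F) := by
  rw [← coeff_zero_eq_constantCoeff_apply, coeff_mapSeries, coeff_zero_eq_constantCoeff_apply]

lemma mapSeries_add (L : LineAlgebra →ₗ[ℝ] ℝ) (F G : PowerSeries LineAlgebra) :
    mapSeries L (F + G) = mapSeries L F + mapSeries L G := by ext n; simp

lemma mapSeries_mass_mul (F G : PowerSeries LineAlgebra) :
    mapSeries mass (F * G) = mapSeries mass F * mapSeries mass G := by
  ext n
  simp only [coeff_mapSeries, coeff_mul, map_sum, mass_mul]

lemma mapSeries_moment2_mul (F G : PowerSeries LineAlgebra) :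
    mapSeries moment2 (F * G) = mapSeries moment2 F * mapSeries mass G
      + 2 * (mapSeries moment1 F * mapSeries moment1 G)
      + mapSeries mass F * mapSeries moment2 G := by
  rw [two_mul]
  ext n
  simp only [coeff_mapSeries, coeff_mul, map_sum, moment2_mul, map_add, Finset.sum_add_distrib]
  rw [← two_mul, Finset.mul_sum]
  congr 2
  exact Finset.sum_congr rfl fun _ _ => by ring

/-- The embedding of scalars as multiples of the unit mass at the origin. -/
abbrev scalar : ℝ →+* LineAlgebra := algebraMap ℝ LineAlgebra

lemma mapSeries_mul_scalar (L : LineAlgebra →ₗ[ℝ] ℝ) (F : PowerSeries LineAlgebra)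
    (b : PowerSeries ℝ) :
    mapSeries L (F * PowerSeries.map scalar b) = mapSeries L F * b := by
  ext n
  simp only [coeff_mapSeries, coeff_mul, map_sum, coeff_map]
  refine Finset.sum_congr rfl fun x _ => ?_
  rw [mul_comm, ← Algebra.smul_def, map_smul, smul_eq_mul, mul_comm]

/-! ### Wiener–Hopf factorization of a symmetric random walk on the line -/

/-- `μ` is a symmetric probability measure with support in `[-M, M]`. -/
structure IsSymmStep (μ : LineAlgebra) (M : ℝ) : Prop where
  nonneg : NonnegCoeff μ
  mass_eq : mass μ = 1
  symm : reflect μ = μ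
  supp : SuppIn (Set.Icc (-M) M) μ

/-- The law at time `n` of the walk started at `0` and killed when it leaves `(0, ∞)` at a
positive time. -/
def killed (μ : LineAlgebra) : ℕ → LineAlgebra
  | 0 => 1
  | n + 1 => posPart (μ * killed μ n)

/-- The generating series of `killed`. -/
def killedSeries (μ : LineAlgebra) : PowerSeries LineAlgebra := PowerSeries.mk (killed μ)

/-- The generating series of the exit laws of the killed walk. -/
def exitSeries (μ : LineAlgebra) : PowerSeries LineAlgebra :=
  (1 - X * C μ) * killedSeries μ

/-- The scalar factor in the Wiener–Hopf factorization. -/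
def scalarFactor (μ : LineAlgebra) : PowerSeries ℝ :=
  mapSeries atZero (exitSeries μ * PowerSeries.map reflect (killedSeries μ))

section
variable {μ : LineAlgebra} {M : ℝ}

lemma coeff_killedSeries (n : ℕ) : coeff n (killedSeries μ) = killed μ n := by
  simp [killedSeries]

lemma coeff_exitSeries_zero : coeff 0 (exitSeries μ) = 1 := by
  simp [exitSeries, sub_mul, mul_assoc, killedSeries, killed]

lemma coeff_exitSeries_succ (n : ℕ) :
    coeff (n + 1) (exitSeries μ) = killed μ (n + 1) - μ * killed μ n := by
  simp [exitSeries, sub_mul, mul_assoc, coeff_succ_X_mul, coeff_C_mul, killedSeries]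

lemma posPart_suppIn (f : LineAlgebra) : SuppIn (Set.Ioi 0) (posPart f) := by
  intro t ht
  rw [posPart_coeff] at ht
  by_contra h
  exact ht (if_neg h)

lemma killed_succ_suppIn (n : ℕ) : SuppIn (Set.Ioi 0) (killed μ (n + 1)) := posPart_suppIn _

lemma killed_suppIn (n : ℕ) : SuppIn (Set.Ici 0) (killed μ n) := by
  cases n with
  | zero => exact SuppIn.one (by simp)
  | succ n => exact (killed_succ_suppIn n).mono Set.Ioi_subset_Ici_self

lemma NonnegCoeff.posPart {f : LineAlgebra} (hf : NonnegCoeff f) : NonnegCoeff (posPart f) := by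
  intro t
  rw [posPart_coeff]
  split_ifs
  · exact hf t
  · exact le_rfl

lemma NonnegCoeff.sub_posPart {f : LineAlgebra} (hf : NonnegCoeff f) :
    NonnegCoeff (f - LatticeHamiltonian.posPart f) := by
  intro t
  rw [AddMonoidAlgebra.coeff_sub, Finsupp.sub_apply, posPart_coeff]
  split_ifs
  · simp
  · simpa using hf t

lemma IsSymmStep.killed_nonneg (h : IsSymmStep μ M) (n : ℕ) : NonnegCoeff (killed μ n) := by
  induction n with
  | zero => exact NonnegCoeff.one
  | succ n ih => exact (h.nonneg.mul ih).posPart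

/-- The law of the exit position at time `n + 1`. -/
def exitLaw (μ : LineAlgebra) (n : ℕ) : LineAlgebra := μ * killed μ n - killed μ (n + 1)

lemma coeff_exitSeries_succ' (n : ℕ) : coeff (n + 1) (exitSeries μ) = -exitLaw μ n := by
  rw [coeff_exitSeries_succ, exitLaw, neg_sub]

lemma IsSymmStep.exitLaw_nonneg (h : IsSymmStep μ M) (n : ℕ) : NonnegCoeff (exitLaw μ n) :=
  (h.nonneg.mul (h.killed_nonneg n)).sub_posPart

/-- The walk jumps out of `[0, ∞)` by a step of size at most `M`, so the overshoot is bounded. This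
later controls the second moment of the exit series. -/
lemma IsSymmStep.exitLaw_suppIn (h : IsSymmStep μ M) (n : ℕ) :
    SuppIn (Set.Icc (-M) 0) (exitLaw μ n) := by
  intro t ht
  have h0 : t ≤ 0 := by
    by_contra h0
    push Not at h0
    refine ht ?_
    rw [exitLaw, killed, AddMonoidAlgebra.coeff_sub, Finsupp.sub_apply, posPart_coeff, if_pos h0,
      sub_self]
  refine ⟨?_, h0⟩
  have h1 : (μ * killed μ n).coeff t ≠ 0 := by
    intro h2
    refine ht ?_
    rw [exitLaw, killed, AddMonoidAlgebra.coeff_sub, Finsupp.sub_apply, posPart_coeff,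
      if_neg h0.not_gt, h2, sub_zero]
  exact (h.supp.mul (killed_suppIn n) (r := Set.Ici (-M))
    fun a ha b hb => by
      have := ha.1
      have : (0 : ℝ) ≤ b := hb
      simp only [Set.mem_Ici]
      linarith) t h1

lemma IsSymmStep.mass_exitLaw (h : IsSymmStep μ M) (n : ℕ) :
    mass (exitLaw μ n) = mass (killed μ n) - mass (killed μ (n + 1)) := by
  rw [exitLaw, map_sub, mass_mul, h.mass_eq, one_mul]

lemma IsSymmStep.mass_killed_nonneg (h : IsSymmStep μ M) (n : ℕ) : 0 ≤ mass (killed μ n) :=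
  (h.killed_nonneg n).pairing_nonneg fun _ _ => zero_le_one

lemma IsSymmStep.mass_exitLaw_nonneg (h : IsSymmStep μ M) (n : ℕ) : 0 ≤ mass (exitLaw μ n) :=
  (h.exitLaw_nonneg n).pairing_nonneg fun _ _ => zero_le_one

lemma IsSymmStep.mass_killed_le (h : IsSymmStep μ M) (n : ℕ) : mass (killed μ n) ≤ 1 := by
  induction n with
  | zero => exact mass_one.le
  | succ n ih => linarith [h.mass_exitLaw n, h.mass_exitLaw_nonneg n]

lemma IsSymmStep.exitSeries_suppIn (h : IsSymmStep μ M) (n : ℕ) :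
    SuppIn (Set.Iic 0) (coeff n (exitSeries μ)) := by
  cases n with
  | zero => rw [coeff_exitSeries_zero]; exact SuppIn.one (by simp)
  | succ n =>
    rw [coeff_exitSeries_succ', ← neg_one_smul ℝ]
    exact ((h.exitLaw_suppIn n).mono fun t ht => ht.2).smul _

lemma map_reflect_reflect (F : PowerSeries LineAlgebra) :
    PowerSeries.map reflect (PowerSeries.map reflect F) = F := by
  ext1 n
  simp [reflect_reflect]

lemma IsSymmStep.map_reflect_exitSeries (h : IsSymmStep μ M) :
    PowerSeries.map reflect (exitSeries μ)
      = (1 - X * C μ) * PowerSeries.map reflect (killedSeries μ) := by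
  simp [exitSeries, h.symm]

/-- The Wiener–Hopf factorization. -/
lemma IsSymmStep.factorization (h : IsSymmStep μ M) :
    exitSeries μ * PowerSeries.map reflect (killedSeries μ)
      = PowerSeries.map scalar (scalarFactor μ) := by
  set W := exitSeries μ * PowerSeries.map reflect (killedSeries μ) with hW
  -- `W = (1 - zμ) U · reflect U` with `U` the killed series, and `μ` is symmetric. As both factors
  -- of `W` also live on `(-∞, 0]`, symmetry leaves only the origin.
  have hsymm : PowerSeries.map reflect W = W := by
    rw [hW, map_mul, map_reflect_reflect, h.map_reflect_exitSeries, exitSeries]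
    ring
  have hsupp : ∀ n, SuppIn (Set.Iic 0) (coeff n W) := by
    intro n
    rw [hW, coeff_mul]
    refine SuppIn.sum fun x _ => ?_
    rw [coeff_map, coeff_killedSeries]
    refine (h.exitSeries_suppIn _).mul
      ((killed_suppIn _).reflect (s' := Set.Iic 0) fun a ha => ?_) fun a ha b hb => ?_
    · simpa using ha
    · exact add_nonpos (Set.mem_Iic.1 ha) (Set.mem_Iic.1 hb)
  ext1 n
  rw [coeff_map, scalarFactor, coeff_mapSeries, ← hW, atZero_apply]
  ext t
  rw [AddMonoidAlgebra.coe_algebraMap]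
  simp only [Function.comp, Algebra.algebraMap_self, RingHom.id_apply,
    AddMonoidAlgebra.coeff_single]
  by_cases ht : t = 0
  · simp [ht]
  · rw [Finsupp.single_apply, if_neg (Ne.symm ht)]
    by_contra hne
    have h1 := hsupp n t hne
    have h2 : (coeff n W).coeff (-t) ≠ 0 := by
      rw [← reflect_coeff, ← coeff_map, hsymm]
      exact hne
    have h3 := hsupp n _ h2
    simp only [Set.mem_Iic] at h1 h3
    exact ht (by linarith)

lemma IsSymmStep.moment1_eq (h : IsSymmStep μ M) : moment1 μ = 0 := by
  have : moment1 μ = -moment1 μ := by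
    conv_lhs => rw [← h.symm, pairing_reflect]
    simp [pairing_apply]
  linarith

/-- This and the next two identities are the moments of `V = (1 - zμ) U`. Since `μ` has mass one and
mean zero, only the second moment picks up an extra term. -/
lemma IsSymmStep.mapSeries_exit_mass (h : IsSymmStep μ M) :
    mapSeries mass (exitSeries μ) = (1 - X) * mapSeries mass (killedSeries μ) := by
  ext n
  cases n with
  | zero => simp [coeff_exitSeries_zero, sub_mul, killedSeries, killed]
  | succ n =>
    simp [coeff_exitSeries_succ, sub_mul, coeff_succ_X_mul, coeff_killedSeries, mass_mul,
      h.mass_eq]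

lemma IsSymmStep.mapSeries_exit_moment1 (h : IsSymmStep μ M) :
    mapSeries moment1 (exitSeries μ) = (1 - X) * mapSeries moment1 (killedSeries μ) := by
  ext n
  cases n with
  | zero => simp [coeff_exitSeries_zero, sub_mul, killedSeries, killed]
  | succ n =>
    simp [coeff_exitSeries_succ, sub_mul, coeff_succ_X_mul, coeff_killedSeries, moment1_mul,
      h.mass_eq, h.moment1_eq]

lemma IsSymmStep.mapSeries_exit_moment2 (h : IsSymmStep μ M) :
    mapSeries moment2 (exitSeries μ) = (1 - X) * mapSeries moment2 (killedSeries μ)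
      - X * C (moment2 μ) * mapSeries mass (killedSeries μ) := by
  ext n
  cases n with
  | zero => simp [coeff_exitSeries_zero, sub_mul, killedSeries, killed, mul_assoc]
  | succ n =>
    simp [coeff_exitSeries_succ, sub_mul, coeff_succ_X_mul, coeff_killedSeries, moment2_mul,
      h.mass_eq, h.moment1_eq, mul_assoc, coeff_C_mul]
    ring

lemma mapSeries_map_reflect (g : ℝ → ℝ) (F : PowerSeries LineAlgebra) :
    mapSeries (pairing g) (PowerSeries.map reflect F) = mapSeries (pairing fun t => g (-t)) F := by
  ext n
  simp [pairing_reflect]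

lemma mapSeries_map_scalar (g : ℝ → ℝ) (b : PowerSeries ℝ) :
    mapSeries (pairing g) (PowerSeries.map scalar b) = C (g 0) * b := by
  ext n
  simp [AddMonoidAlgebra.coe_algebraMap, mul_comm]

/-- The mass identity of the factorization. -/
lemma IsSymmStep.mass_identity (h : IsSymmStep μ M) :
    mapSeries mass (exitSeries μ) * mapSeries mass (killedSeries μ) = scalarFactor μ := by
  have := congrArg (mapSeries mass) h.factorization
  rwa [mapSeries_mass_mul, mapSeries_map_reflect, mapSeries_map_scalar, map_one, one_mul] at this

/-- The second moment identity of the factorization. -/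
lemma IsSymmStep.moment_identity (h : IsSymmStep μ M) :
    2 * (mapSeries moment2 (exitSeries μ) * mapSeries mass (exitSeries μ))
      + X * C (moment2 μ) * scalarFactor μ = 2 * mapSeries moment1 (exitSeries μ) ^ 2 := by
  have h2 := congrArg (mapSeries moment2) h.factorization
  rw [mapSeries_moment2_mul, mapSeries_map_reflect, mapSeries_map_reflect, mapSeries_map_reflect,
    mapSeries_map_scalar] at h2
  have hneg : mapSeries (pairing fun t => -t) (killedSeries μ)
      = -mapSeries moment1 (killedSeries μ) := by
    ext n
    simp [pairing_apply]
  have hsq : (fun t : ℝ => (-t) ^ 2) = fun t => t ^ 2 := by ext; ring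
  rw [hneg, hsq] at h2
  simp only [ne_eq, OfNat.ofNat_ne_zero, not_false_eq_true, zero_pow, map_zero, zero_mul] at h2
  have h0 := h.mass_identity
  have e0 := h.mapSeries_exit_mass
  have e1 := h.mapSeries_exit_moment1
  have e2 := h.mapSeries_exit_moment2
  rw [← h0]
  set a0 := mapSeries mass (killedSeries μ)
  set a1 := mapSeries moment1 (killedSeries μ)
  set a2 := mapSeries moment2 (killedSeries μ)
  set v0 := mapSeries mass (exitSeries μ)
  set v1 := mapSeries moment1 (exitSeries μ)
  set v2 := mapSeries moment2 (exitSeries μ)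
  -- Here `h2` says that the second moment of a multiple of the unit mass at `0` vanishes.
  -- Multiplying it by `1 - X` converts moments of the killed series into moments of the exit
  -- series.
  linear_combination (1 - X) * h2 + v2 * e0 - (2 * v1) * e1 + v0 * e2

/-- The generating series of the return probabilities. -/
def returnSeries (μ : LineAlgebra) : PowerSeries ℝ :=
  PowerSeries.mk fun n => atZero (μ ^ (n + 1))

lemma atZero_mul_of_suppIn {f g : LineAlgebra} (hf : SuppIn (Set.Ioi 0) f)
    (hg : SuppIn (Set.Ici 0) g) : atZero (f * g) = 0 := by
  rw [atZero_apply]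
  by_contra hne
  have : (0 : ℝ) < 0 := hf.mul hg (r := Set.Ioi 0)
    (fun a ha b hb => add_pos_of_pos_of_nonneg (Set.mem_Ioi.1 ha) (Set.mem_Ici.1 hb)) 0 hne
  exact lt_irrefl _ this

lemma atZero_reflect (f : LineAlgebra) : atZero (reflect f) = atZero f := by
  rw [atZero_apply, atZero_apply, reflect_coeff, neg_zero]

/-- The logarithmic derivative of the scalar factor. -/
lemma IsSymmStep.derivative_scalarFactor (h : IsSymmStep μ M) :
    derivative ℝ (scalarFactor μ) = -(returnSeries μ * scalarFactor μ) := by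
  have hW := h.factorization
  have hR := h.map_reflect_exitSeries
  set U := killedSeries μ with hU
  set V := exitSeries μ with hV
  set U' := PowerSeries.map reflect U with hU'
  set V' := PowerSeries.map reflect V with hV'
  set W := PowerSeries.map scalar (scalarFactor μ) with hWdef
  have hVU : V = (1 - X * C μ) * U := rfl
  set G : PowerSeries LineAlgebra := PowerSeries.mk fun n => μ ^ n with hG
  have hGinv : (1 - X * C μ) * G = 1 := by
    ext1 n
    cases n with
    | zero => simp [hG, sub_mul, mul_assoc]
    | succ n => simp [hG, sub_mul, mul_assoc, coeff_succ_X_mul, coeff_C_mul, coeff_one, pow_succ']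
  -- Differentiate `W = (1 - zμ) U U'`. The first factor yields `-μ (1 - zμ)⁻¹ W`; in the other two
  -- terms `1 - zμ` is absorbed into `V'` or `V`.
  have hder : derivative LineAlgebra W = -(C μ * G * W) + derivative LineAlgebra U * V'
      + derivative LineAlgebra U' * V := by
    have hD : derivative LineAlgebra (1 - X * C μ : PowerSeries LineAlgebra) = -C μ := by
      ext1 n
      simp
    have hW2 : W = (1 - X * C μ) * (U * U') := by rw [← hW, hVU]; ring
    have hUU : G * W = U * U' := by
      rw [hW2, ← mul_assoc, mul_comm G, hGinv, one_mul]
    rw [mul_assoc, hUU, hW2, Derivation.leibniz, Derivation.leibniz, hD, hR, hVU]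
    simp only [smul_eq_mul]
    ring
  -- Differentiation discards the unit mass at time `0`, so the derivative of `U` lives on the open
  -- half-line while `V'` lives on `[0, ∞)`: their product has no mass at the origin. The remaining
  -- term is its reflection.
  have hpos : ∀ n, coeff n (mapSeries atZero (derivative LineAlgebra U * V')) = 0 := by
    intro n
    rw [coeff_mapSeries, coeff_mul, map_sum]
    refine Finset.sum_eq_zero fun x _ => ?_
    refine atZero_mul_of_suppIn ?_ ?_
    · rw [coeff_derivative, hU, coeff_killedSeries, mul_comm]
      have : ((x.1 : LineAlgebra) + 1) = scalar (x.1 + 1) := by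
        rw [map_add, map_natCast, map_one]
      rw [this, ← Algebra.smul_def]
      exact (killed_succ_suppIn _).smul _
    · rw [hV', coeff_map]
      exact (h.exitSeries_suppIn _).reflect fun a ha => by simpa using ha
  have hneg : ∀ n, coeff n (mapSeries atZero (derivative LineAlgebra U' * V)) = 0 := by
    intro n
    rw [← hpos n, coeff_mapSeries, coeff_mapSeries, ← atZero_reflect, ← coeff_map]
    congr 2
    rw [map_mul]
    congr 1
    ext1 k
    rw [coeff_map, coeff_derivative, coeff_derivative, hU', coeff_map, map_mul, reflect_reflect]
    simp
  have hC : C μ * G = PowerSeries.mk fun n => μ ^ (n + 1) := by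
    ext1 n
    simp [hG, coeff_C_mul, pow_succ']
  have hL : mapSeries atZero (derivative LineAlgebra W) = derivative ℝ (scalarFactor μ) := by
    ext n
    rw [coeff_mapSeries, coeff_derivative, coeff_derivative, hWdef, coeff_map]
    have : ((n : LineAlgebra) + 1) = scalar (n + 1) := by
      rw [map_add, map_natCast, map_one]
    rw [this, ← map_mul, atZero]
    simp [AddMonoidAlgebra.coe_algebraMap]
  rw [← hL, hder, mapSeries_add, mapSeries_add]
  ext n
  rw [map_add, map_add, hpos, hneg, add_zero, add_zero, hWdef]
  have : mapSeries atZero (-(C μ * G * PowerSeries.map scalar (scalarFactor μ)))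
      = -mapSeries atZero (C μ * G * PowerSeries.map scalar (scalarFactor μ)) := by
    ext k; simp
  rw [this, mapSeries_mul_scalar, hC]
  have hret : mapSeries atZero (PowerSeries.mk fun n => μ ^ (n + 1)) = returnSeries μ := by
    ext k; simp [returnSeries]
  rw [hret]

end

/-! ### Evaluation of real power series -/

/-- Absolute convergence of a power series at `z`. -/
def SummableAt (z : ℝ) (F : PowerSeries ℝ) : Prop := Summable fun n => ‖coeff n F * z ^ n‖

/-- The sum of a power series at `z`. -/
def evalAt (z : ℝ) (F : PowerSeries ℝ) : ℝ := ∑' n, coeff n F * z ^ n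

section
variable {z : ℝ} {F G : PowerSeries ℝ}

lemma SummableAt.summable (hF : SummableAt z F) : Summable fun n => coeff n F * z ^ n :=
  Summable.of_norm hF

lemma SummableAt.add (hF : SummableAt z F) (hG : SummableAt z G) : SummableAt z (F + G) := by
  refine Summable.of_nonneg_of_le (fun _ => norm_nonneg _) (fun n => ?_) (Summable.add hF hG)
  rw [map_add, add_mul]
  exact norm_add_le _ _

lemma evalAt_add (hF : SummableAt z F) (hG : SummableAt z G) :
    evalAt z (F + G) = evalAt z F + evalAt z G := by
  simp only [evalAt, map_add, add_mul]
  exact hF.summable.tsum_add hG.summable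

lemma SummableAt.neg (hF : SummableAt z F) : SummableAt z (-F) := by
  simpa [SummableAt] using hF

lemma evalAt_neg : evalAt z (-F) = -evalAt z F := by
  simp [evalAt, tsum_neg]

lemma coeff_mul_mul_pow (F G : PowerSeries ℝ) (z : ℝ) (n : ℕ) :
    coeff n (F * G) * z ^ n = ∑ kl ∈ Finset.HasAntidiagonal.antidiagonal n,
      (coeff kl.1 F * z ^ kl.1) * (coeff kl.2 G * z ^ kl.2) := by
  rw [coeff_mul, Finset.sum_mul]
  refine Finset.sum_congr rfl fun kl h => ?_
  rw [← Finset.HasAntidiagonal.mem_antidiagonal.1 h, pow_add]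
  ring

lemma SummableAt.mul (hF : SummableAt z F) (hG : SummableAt z G) : SummableAt z (F * G) := by
  have := summable_norm_sum_mul_antidiagonal_of_summable_norm hF hG
  unfold SummableAt
  simp only [coeff_mul_mul_pow]
  exact this

lemma evalAt_mul (hF : SummableAt z F) (hG : SummableAt z G) :
    evalAt z (F * G) = evalAt z F * evalAt z G := by
  have := tsum_mul_tsum_eq_tsum_sum_antidiagonal_of_summable_norm hF hG
  unfold evalAt
  rw [this]
  simp only [coeff_mul_mul_pow]

lemma evalAt_eq_of_coeff_eq_zero {k : ℕ} (h : ∀ n, n ≠ k → coeff n F = 0) :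
    SummableAt z F ∧ evalAt z F = coeff k F * z ^ k := by
  constructor
  · exact summable_of_ne_finset_zero (s := {k}) fun n hn => by
      rw [h n (by simpa using hn)]; simp
  · exact tsum_eq_single k fun n hn => by rw [h n hn, zero_mul]

lemma summableAt_X : SummableAt z X :=
  (evalAt_eq_of_coeff_eq_zero (k := 1) fun n hn => by simp [coeff_X, hn]).1

lemma evalAt_X : evalAt z X = z := by
  rw [(evalAt_eq_of_coeff_eq_zero (k := 1) fun n hn => by simp [coeff_X, hn]).2]
  simp

lemma summableAt_C (c : ℝ) : SummableAt z (C c) :=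
  (evalAt_eq_of_coeff_eq_zero (k := 0) fun n hn => by simp [coeff_C, hn]).1

lemma evalAt_C (c : ℝ) : evalAt z (C c) = c := by
  rw [(evalAt_eq_of_coeff_eq_zero (k := 0) fun n hn => by simp [coeff_C, hn]).2]
  simp

lemma summableAt_of_bounded {K : ℝ} (h : ∀ n, |coeff n F| ≤ K) (hz : |z| < 1) :
    SummableAt z F := by
  refine Summable.of_nonneg_of_le (fun _ => norm_nonneg _) (fun n => ?_)
    ((summable_geometric_of_lt_one (abs_nonneg z) hz).mul_left K)
  rw [norm_mul, norm_pow, Real.norm_eq_abs, Real.norm_eq_abs]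
  exact mul_le_mul_of_nonneg_right (h n) (by positivity)

/-- Linear growth is allowed because the scalar factor is a product of two series with bounded
coefficients. -/
lemma hasDerivAt_evalAt {K : ℝ} (h : ∀ n, |coeff n F| ≤ K * (n + 1)) (hz : |z| < 1) :
    HasDerivAt (fun y => evalAt y F) (evalAt z (derivative ℝ F)) z := by
  obtain ⟨r, hzr, hr1⟩ := exists_between hz
  have hr0 : 0 ≤ r := (abs_nonneg z).trans hzr.le
  have hu : Summable fun n : ℕ => K * (n + 1) * (n * r ^ (n - 1)) := by
    rw [← summable_nat_add_iff 1]
    have hr : ‖r‖ < 1 := by rwa [Real.norm_eq_abs, abs_of_nonneg hr0]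
    have h2 := summable_pow_mul_geometric_of_norm_lt_one 2 hr
    have h1 := summable_pow_mul_geometric_of_norm_lt_one 1 hr
    have h0 := summable_pow_mul_geometric_of_norm_lt_one 0 hr
    -- After the index shift the polynomial factor is `(n + 2)(n + 1) = n² + 3n + 2`.
    refine (((h2.add (h1.mul_left 3)).add (h0.mul_left 2)).mul_left K).congr fun n => ?_
    rw [Nat.add_sub_cancel]
    push_cast
    ring
  have hz0 : SummableAt z F := by
    have hr : ‖z‖ < 1 := hz
    refine Summable.of_nonneg_of_le (fun _ => norm_nonneg _) (fun n => ?_)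
      (((summable_pow_mul_geometric_of_norm_lt_one 1 hr).norm.add
        (summable_pow_mul_geometric_of_norm_lt_one 0 hr).norm).mul_left K)
    rw [norm_mul, norm_pow]
    refine (mul_le_mul_of_nonneg_right (h n) (by positivity)).trans (le_of_eq ?_)
    simp
    ring
  have key := hasDerivAt_tsum_of_isPreconnected (𝕜 := ℝ) (t := Metric.ball (0 : ℝ) r)
    (g := fun n y => coeff n F * y ^ n) (g' := fun n y => coeff n F * (n * y ^ (n - 1)))
    (y₀ := z) (y := z) hu Metric.isOpen_ball
    (convex_ball (0 : ℝ) r).isPreconnected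
    (fun n y _ => (hasDerivAt_pow n y).const_mul _)
    (fun n y hy => by
      rw [mem_ball_zero_iff] at hy
      rw [norm_mul, norm_mul, norm_pow, Real.norm_natCast]
      exact mul_le_mul (h n) (by gcongr) (by positivity) ((abs_nonneg _).trans (h n)))
    (by simpa using hzr) hz0.summable (by simpa using hzr)
  have hs : Summable fun n : ℕ => coeff n F * (n * z ^ (n - 1)) := by
    refine Summable.of_norm_bounded hu fun n => ?_
    rw [norm_mul, norm_mul, norm_pow, Real.norm_natCast]
    exact mul_le_mul (h n) (by gcongr; exact hzr.le) (by positivity) ((abs_nonneg _).trans (h n))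
  have e : ∑' n : ℕ, coeff n F * (n * z ^ (n - 1)) = evalAt z (derivative ℝ F) := by
    rw [hs.tsum_eq_zero_add]
    simp [evalAt, coeff_derivative, mul_assoc]
  rw [e] at key
  exact key

end

/-! ### The limit at the critical parameter -/

section
variable {μ : LineAlgebra} {M : ℝ}

lemma IsSymmStep.return_nonneg (h : IsSymmStep μ M) (n : ℕ) : 0 ≤ atZero (μ ^ n) := by
  rw [atZero_apply]
  exact h.nonneg.pow n 0

lemma IsSymmStep.return_le_one (h : IsSymmStep μ M) (n : ℕ) : atZero (μ ^ n) ≤ 1 := by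
  have := (h.nonneg.pow n).abs_pairing_le (g := Pi.single 0 1) (C := 1) fun t _ => by
    rcases eq_or_ne t 0 with rfl | ht
    · simp
    · simp [ht]
  rw [mass_pow, h.mass_eq, one_pow, mul_one] at this
  exact (le_abs_self _).trans this

/-- The primitive of the series of return probabilities. -/
def returnPrimitive (μ : LineAlgebra) : PowerSeries ℝ :=
  PowerSeries.mk fun n => atZero (μ ^ n) / n

lemma derivative_returnPrimitive : derivative ℝ (returnPrimitive μ) = returnSeries μ := by
  ext n
  rw [coeff_derivative]
  simp only [returnPrimitive, returnSeries, coeff_mk]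
  push_cast
  field_simp

lemma IsSymmStep.abs_coeff_returnPrimitive_le (h : IsSymmStep μ M) (n : ℕ) :
    |coeff n (returnPrimitive μ)| ≤ 1 := by
  simp only [returnPrimitive, coeff_mk]
  rw [abs_div, abs_of_nonneg (h.return_nonneg n), Nat.abs_cast]
  rcases n.eq_zero_or_pos with rfl | hn
  · simp
  · rw [div_le_one (by positivity)]
    exact (h.return_le_one n).trans (by exact_mod_cast hn)

lemma IsSymmStep.abs_mass_exit_le (h : IsSymmStep μ M) (n : ℕ) :
    |coeff n (mapSeries mass (exitSeries μ))| ≤ 1 := by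
  rw [coeff_mapSeries]
  cases n with
  | zero => rw [coeff_exitSeries_zero, mass_one, abs_one]
  | succ n =>
    rw [coeff_exitSeries_succ', map_neg, abs_neg, abs_of_nonneg (h.mass_exitLaw_nonneg n),
      h.mass_exitLaw]
    linarith [h.mass_killed_le n, h.mass_killed_nonneg (n + 1)]

lemma IsSymmStep.abs_mass_killed_le (h : IsSymmStep μ M) (n : ℕ) :
    |coeff n (mapSeries mass (killedSeries μ))| ≤ 1 := by
  rw [coeff_mapSeries, coeff_killedSeries, abs_of_nonneg (h.mass_killed_nonneg n)]
  exact h.mass_killed_le n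

lemma IsSymmStep.abs_scalarFactor_le (h : IsSymmStep μ M) (n : ℕ) :
    |coeff n (scalarFactor μ)| ≤ 1 * (n + 1) := by
  rw [← h.mass_identity, coeff_mul]
  refine (Finset.abs_sum_le_sum_abs _ _).trans
    ((Finset.sum_le_card_nsmul _ _ 1 fun x _ => ?_).trans (le_of_eq (by simp)))
  rw [abs_mul]
  exact mul_le_one₀ (h.abs_mass_exit_le _) (abs_nonneg _) (h.abs_mass_killed_le _)

lemma coeff_scalarFactor_zero : coeff 0 (scalarFactor μ) = 1 := by
  rw [scalarFactor, coeff_mapSeries, coeff_mul]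
  simp [coeff_killedSeries, killed, atZero_apply, AddMonoidAlgebra.one_def,
    coeff_exitSeries_zero]

lemma IsSymmStep.summableAt_scalarFactor (h : IsSymmStep μ M) {z : ℝ} (hz : |z| < 1) :
    SummableAt z (scalarFactor μ) := by
  rw [← h.mass_identity]
  exact (summableAt_of_bounded h.abs_mass_exit_le hz).mul
    (summableAt_of_bounded h.abs_mass_killed_le hz)

lemma evalAt_zero (F : PowerSeries ℝ) : evalAt 0 F = coeff 0 F := by
  rw [evalAt, tsum_eq_single 0 fun n hn => by simp [hn]]
  simp

/-- The scalar factor is the exponential of the negative return series. -/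
lemma IsSymmStep.evalAt_scalarFactor (h : IsSymmStep μ M) {z : ℝ} (hz : |z| < 1) :
    evalAt z (scalarFactor μ) = Real.exp (-evalAt z (returnPrimitive μ)) := by
  have hret : ∀ n, |coeff n (returnSeries μ)| ≤ 1 := fun n => by
    simp only [returnSeries, coeff_mk]
    rw [abs_of_nonneg (h.return_nonneg _)]
    exact h.return_le_one _
  -- The product of the scalar factor with the exponential of the return primitive has zero
  -- derivative on the unit interval, and equals `1` at `0`.
  have hd : ∀ y ∈ Metric.ball (0 : ℝ) 1, HasDerivAt
      (fun y => evalAt y (scalarFactor μ) * Real.exp (evalAt y (returnPrimitive μ))) 0 y := by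
    intro y hy
    have hy : |y| < 1 := by simpa using hy
    have h1 := hasDerivAt_evalAt h.abs_scalarFactor_le hy
    have h2 := hasDerivAt_evalAt (F := returnPrimitive μ) (K := 1) (fun n =>
      (h.abs_coeff_returnPrimitive_le n).trans (by
        have : (0 : ℝ) ≤ n := n.cast_nonneg
        linarith)) hy
    rw [derivative_returnPrimitive] at h2
    rw [h.derivative_scalarFactor, evalAt_neg,
      evalAt_mul (summableAt_of_bounded hret hy) (h.summableAt_scalarFactor hy)] at h1
    refine (h1.mul h2.exp).congr_deriv ?_
    ring
  have hconst := (convex_ball (0 : ℝ) 1).is_const_of_fderivWithin_eq_zero (𝕜 := ℝ)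
    (f := fun y => evalAt y (scalarFactor μ) * Real.exp (evalAt y (returnPrimitive μ)))
    (fun y hy => (hd y hy).differentiableAt.differentiableWithinAt)
    (fun y hy => by
      rw [fderivWithin_of_isOpen Metric.isOpen_ball hy, (hd y hy).hasFDerivAt.fderiv]
      ext
      simp)
    (x := z) (y := 0) (by simpa using hz) (by simp)
  simp only [evalAt_zero, coeff_scalarFactor_zero] at hconst
  -- The coefficient of index `0` is a quotient by `0`, hence `0`.
  have h0 : coeff 0 (returnPrimitive μ) = 0 := by simp [returnPrimitive]
  rw [h0, Real.exp_zero, mul_one] at hconst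
  rw [Real.exp_neg]
  exact eq_inv_of_mul_eq_one_left hconst

lemma IsSymmStep.abs_moment2_exit_le (h : IsSymmStep μ M) (n : ℕ) :
    |moment2 (exitLaw μ n)| ≤ M ^ 2 * mass (exitLaw μ n) := by
  refine (h.exitLaw_nonneg n).abs_pairing_le fun t ht => ?_
  have := h.exitLaw_suppIn n t ht
  rw [abs_of_nonneg (sq_nonneg t)]
  exact sq_le_sq' this.1 (by linarith [this.1, this.2])

lemma IsSymmStep.summableAt_moment2_exit (h : IsSymmStep μ M) {z : ℝ} (hz : |z| < 1) :
    SummableAt z (mapSeries moment2 (exitSeries μ)) := by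
  refine summableAt_of_bounded (K := M ^ 2) (fun n => ?_) hz
  rw [coeff_mapSeries]
  cases n with
  | zero =>
    rw [coeff_exitSeries_zero]
    simp [AddMonoidAlgebra.one_def, sq_nonneg]
  | succ n =>
    rw [coeff_exitSeries_succ', map_neg, abs_neg]
    refine (h.abs_moment2_exit_le n).trans ?_
    rw [h.mass_exitLaw]
    exact mul_le_of_le_one_right (sq_nonneg M)
      (by linarith [h.mass_killed_le n, h.mass_killed_nonneg (n + 1)])

lemma IsSymmStep.evalAt_mass_exit (h : IsSymmStep μ M) {z : ℝ} (hz : |z| < 1) :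
    evalAt z (mapSeries mass (exitSeries μ))
      = (1 - z) * evalAt z (mapSeries mass (killedSeries μ)) := by
  have h1 : SummableAt z (1 : PowerSeries ℝ) := by simpa using summableAt_C (z := z) 1
  have h2 : evalAt z (1 : PowerSeries ℝ) = 1 := by simpa using evalAt_C (z := z) 1
  rw [h.mapSeries_exit_mass, sub_eq_add_neg, evalAt_mul (h1.add summableAt_X.neg)
    (summableAt_of_bounded h.abs_mass_killed_le hz), evalAt_add h1 summableAt_X.neg, evalAt_neg,
    evalAt_X, h2, sub_eq_add_neg]

lemma IsSymmStep.evalAt_mass_killed_nonneg (h : IsSymmStep μ M) {z : ℝ} (hz : 0 ≤ z) :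
    0 ≤ evalAt z (mapSeries mass (killedSeries μ)) :=
  tsum_nonneg fun n => by
    rw [coeff_mapSeries, coeff_killedSeries]
    exact mul_nonneg (h.mass_killed_nonneg n) (pow_nonneg hz n)

/-- Overshoots are at most `M` and the total exit mass is at most one. The bound is uniform up to `z
= 1`, where this factor multiplies a quantity tending to `0`. -/
lemma IsSymmStep.abs_evalAt_moment2_exit_le (h : IsSymmStep μ M) {z : ℝ} (hz0 : 0 ≤ z)
    (hz : z < 1) : |evalAt z (mapSeries moment2 (exitSeries μ))| ≤ M ^ 2 := by
  have hz' : |z| < 1 := by rwa [abs_of_nonneg hz0]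
  have hs := summableAt_of_bounded h.abs_mass_exit_le hz'
  -- The exit series is `1` minus the series of exit laws; the indicator removes that `1` and leaves
  -- the nonnegative exit masses.
  have hle : ∀ n, ‖coeff n (mapSeries moment2 (exitSeries μ)) * z ^ n‖
      ≤ M ^ 2 * ((if n = 0 then 1 else 0) - coeff n (mapSeries mass (exitSeries μ)) * z ^ n) := by
    intro n
    rw [coeff_mapSeries, coeff_mapSeries]
    cases n with
    | zero =>
      rw [coeff_exitSeries_zero, mass_one]
      simp [AddMonoidAlgebra.one_def]
    | succ n =>
      rw [coeff_exitSeries_succ', map_neg, map_neg, norm_mul, norm_neg, norm_pow,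
        Real.norm_eq_abs, Real.norm_eq_abs, abs_of_nonneg hz0, if_neg (Nat.succ_ne_zero n)]
      refine (mul_le_mul_of_nonneg_right (h.abs_moment2_exit_le n) (by positivity)).trans
        (le_of_eq (by ring))
  have hsum : Summable fun n : ℕ => (if n = 0 then (1 : ℝ) else 0) :=
    summable_of_ne_finset_zero (s := {0}) fun n hn => by simpa using hn
  have hs' := (hsum.sub hs.summable).mul_left (M ^ 2)
  have := tsum_of_norm_bounded hs'.hasSum hle
  rw [Real.norm_eq_abs] at this
  refine this.trans ?_
  rw [tsum_mul_left, hsum.tsum_sub hs.summable, tsum_ite_eq]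
  refine mul_le_of_le_one_right (sq_nonneg M) ?_
  have h0 : 0 ≤ evalAt z (mapSeries mass (exitSeries μ)) := by
    rw [h.evalAt_mass_exit hz']
    exact mul_nonneg (by linarith) (h.evalAt_mass_killed_nonneg hz0)
  unfold evalAt at h0
  linarith

lemma pairing_mul_comm_avg (g : ℝ → ℝ) (μ f : LineAlgebra) :
    pairing g (μ * f) = pairing (fun t => pairing (fun s => g (s + t)) μ) f := by
  induction μ using AddMonoidAlgebra.induction_linear with
  | zero => simp [pairing_apply]
  | add a b ha hb =>
    rw [add_mul, map_add, ha, hb]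
    simp only [pairing_apply _ f, ← Finset.sum_add_distrib, ← mul_add, map_add]
  | single s c =>
    rw [pairing_single_mul]
    simp only [pairing_single]
    rw [pairing_apply, pairing_apply, Finset.mul_sum]
    exact Finset.sum_congr rfl fun _ _ => by ring

/-- The value at the origin of the average of a function which is harmonic for the killed walk
and at bounded distance from the identity. -/
theorem IsSymmStep.sq_mean_harmonic (h : IsSymmStep μ M)
    (hA : Summable fun n : ℕ => atZero (μ ^ n) / n) {g : ℝ → ℝ} {K : ℝ}
    (hg0 : ∀ t ≤ 0, g t = 0) (hharm : ∀ t, 0 < t → pairing (fun s => g (s + t)) μ = g t)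
    (hK : ∀ t, 0 ≤ t → |g t - t| ≤ K) :
    2 * (pairing g μ) ^ 2 = moment2 μ * Real.exp (-∑' n : ℕ, atZero (μ ^ n) / n) := by
  set m := pairing g μ with hm
  -- Exits cost nothing since `g = 0` on `(-∞, 0]`, and `g` is harmonic on `(0, ∞)`, so the mean of
  -- `g` is constant from time one on. At time zero the walk sits at `0`, where harmonicity is not
  -- assumed.
  have hw : ∀ n, pairing g (killed μ (n + 1)) = m := by
    have hstep : ∀ n, pairing g (killed μ (n + 1)) = pairing g (μ * killed μ n) := by
      intro n
      have : pairing g (exitLaw μ n) = 0 := by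
        rw [pairing_congr (g' := fun _ => 0) fun t ht => hg0 t (h.exitLaw_suppIn n t ht).2]
        simp [pairing_apply]
      rw [exitLaw, map_sub] at this
      linarith
    intro n
    induction n with
    | zero => rw [hstep, killed, mul_one]
    | succ n ih =>
      rw [hstep, pairing_mul_comm_avg, ← ih]
      exact pairing_congr fun t ht => hharm t (killed_succ_suppIn n t ht)
  have hw0 : pairing g (killed μ 0) = 0 := by
    simp [killed, AddMonoidAlgebra.one_def, hg0]
  have hT : ∀ n, |pairing g (killed μ n) - moment1 (killed μ n)| ≤ K * mass (killed μ n) := by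
    intro n
    have e : pairing g (killed μ n) - moment1 (killed μ n)
        = pairing (fun t => g t - t) (killed μ n) := by
      simp only [pairing_apply, ← Finset.sum_sub_distrib, mul_sub]
    rw [e]
    exact (h.killed_nonneg n).abs_pairing_le fun t ht => hK t (killed_suppIn n t ht)
  have hK0 : 0 ≤ K := (abs_nonneg _).trans (hK 0 le_rfl)
  have hTb : ∀ n, |coeff n (mapSeries moment1 (killedSeries μ))| ≤ K + |m| := by
    intro n
    rw [coeff_mapSeries, coeff_killedSeries]
    have h1 := hT n
    have h2 : |pairing g (killed μ n)| ≤ |m| := by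
      cases n with
      | zero => rw [hw0, abs_zero]; positivity
      | succ n => rw [hw]
    have h3 : K * mass (killed μ n) ≤ K := mul_le_of_le_one_right hK0 (h.mass_killed_le n)
    rw [abs_le] at h1 h2 ⊢
    constructor <;> linarith [h1.1, h1.2, h2.1, h2.2]
  -- the values at `z`
  set f0 : ℝ → ℝ := fun z => evalAt z (mapSeries mass (exitSeries μ)) with hf0
  set f1 : ℝ → ℝ := fun z => evalAt z (mapSeries moment1 (exitSeries μ)) with hf1
  set v2 : ℝ → ℝ := fun z => evalAt z (mapSeries moment2 (exitSeries μ)) with hv2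
  set b : ℝ → ℝ := fun z => evalAt z (scalarFactor μ) with hb
  have hone : ∀ z, SummableAt z (1 : PowerSeries ℝ) ∧ evalAt z (1 : PowerSeries ℝ) = 1 :=
    fun z => ⟨by simpa using summableAt_C (z := z) 1, by simpa using evalAt_C (z := z) 1⟩
  have hf1eq : ∀ z, |z| < 1 → SummableAt z (mapSeries moment1 (exitSeries μ)) ∧
      f1 z = (1 - z) * evalAt z (mapSeries moment1 (killedSeries μ)) := by
    intro z hz
    have hs := summableAt_of_bounded hTb hz
    simp only [hf1]
    rw [h.mapSeries_exit_moment1, sub_eq_add_neg]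
    refine ⟨((hone z).1.add summableAt_X.neg).mul hs, ?_⟩
    rw [evalAt_mul ((hone z).1.add summableAt_X.neg) hs, evalAt_add (hone z).1 summableAt_X.neg,
      evalAt_neg, evalAt_X, (hone z).2, sub_eq_add_neg]
  have hsq : ∀ z, |z| < 1 → f0 z ^ 2 = (1 - z) * b z := by
    intro z hz
    simp only [hb]
    rw [← h.mass_identity, evalAt_mul (summableAt_of_bounded h.abs_mass_exit_le hz)
      (summableAt_of_bounded h.abs_mass_killed_le hz)]
    have := h.evalAt_mass_exit hz
    simp only [hf0]
    linear_combination (evalAt z (mapSeries mass (exitSeries μ))) * this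
  have hmom : ∀ z, |z| < 1 → 2 * (v2 z * f0 z) + z * moment2 μ * b z = 2 * f1 z ^ 2 := by
    intro z hz
    have e := congrArg (evalAt z) h.moment_identity
    have s0 := summableAt_of_bounded h.abs_mass_exit_le hz
    have s1 := (hf1eq z hz).1
    have s2 := h.summableAt_moment2_exit hz
    have sb := h.summableAt_scalarFactor hz
    rw [two_mul, two_mul, pow_two, evalAt_add ((s2.mul s0).add (s2.mul s0))
      ((summableAt_X.mul (summableAt_C _)).mul sb), evalAt_add (s2.mul s0) (s2.mul s0),
      evalAt_mul s2 s0, evalAt_mul (summableAt_X.mul (summableAt_C _)) sb,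
      evalAt_mul summableAt_X (summableAt_C _), evalAt_X, evalAt_C,
      evalAt_add (s1.mul s1) (s1.mul s1), evalAt_mul s1 s1] at e
    simp only [hv2, hf0, hf1, hb]
    linear_combination e
  -- Since `(1 - z) ∑_{n ≥ 1} m z^n = z m`, the difference is `(1 - z)` times the series of means of
  -- `g t - t`, hence at most `K (1 - z)` times the mass series, which is `K * f0 z`.
  have hdiff : ∀ z, 0 ≤ z → z < 1 → |z * m - f1 z| ≤ K * f0 z := by
    intro z hz0 hz1
    have hz : |z| < 1 := by rwa [abs_of_nonneg hz0]
    have sT := summableAt_of_bounded hTb hz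
    have sa := summableAt_of_bounded h.abs_mass_killed_le hz
    have hgeo : HasSum (fun n => pairing g (killed μ n) * z ^ n) (m * (z * (1 - z)⁻¹)) := by
      rw [← hasSum_nat_add_iff' 1]
      simp only [hw, Finset.range_one, Finset.sum_singleton, hw0, zero_mul, sub_zero]
      simpa [pow_succ, mul_comm] using
        ((hasSum_geometric_of_lt_one hz0 hz1).mul_left z).mul_left m
    have hsub := hgeo.sub sT.summable.hasSum
    have hle := tsum_of_norm_bounded (sa.summable.hasSum.mul_left K) (f := fun n =>
      pairing g (killed μ n) * z ^ n - coeff n (mapSeries moment1 (killedSeries μ)) * z ^ n)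
      (fun n => by
        rw [coeff_mapSeries, coeff_mapSeries, coeff_killedSeries, ← sub_mul, norm_mul, norm_pow,
          Real.norm_eq_abs, Real.norm_eq_abs, abs_of_nonneg hz0, ← mul_assoc]
        exact mul_le_mul_of_nonneg_right (hT n) (by positivity))
    rw [hsub.tsum_eq, Real.norm_eq_abs] at hle
    have h1z : (0 : ℝ) < 1 - z := by linarith
    have e1 : z * m - f1 z = (1 - z) * (m * (z * (1 - z)⁻¹)
        - evalAt z (mapSeries moment1 (killedSeries μ))) := by
      rw [(hf1eq z hz).2]
      field_simp
    have e0 : f0 z = (1 - z) * evalAt z (mapSeries mass (killedSeries μ)) :=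
      h.evalAt_mass_exit hz
    rw [e1, e0, abs_mul, abs_of_pos h1z, mul_left_comm K]
    exact mul_le_mul_of_nonneg_left hle h1z.le
  -- passage to the limit
  have hev : ∀ᶠ z in 𝓝[<] (1 : ℝ), 0 ≤ z ∧ z < 1 :=
    by
    filter_upwards [Ioo_mem_nhdsLT (zero_lt_one (α := ℝ))] with z hz using ⟨hz.1.le, hz.2⟩
  have habs : ∀ z : ℝ, 0 ≤ z ∧ z < 1 → |z| < 1 := fun z hz => by
    rw [abs_of_nonneg hz.1]; exact hz.2
  have hz1 : Tendsto (fun z : ℝ => z) (𝓝[<] 1) (𝓝 1) := tendsto_nhdsWithin_of_tendsto_nhds tendsto_id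
  have hblim : Tendsto b (𝓝[<] 1) (𝓝 (Real.exp (-∑' n : ℕ, atZero (μ ^ n) / n))) := by
    have hlim : Tendsto (fun z => evalAt z (returnPrimitive μ)) (𝓝[<] 1)
        (𝓝 (∑' n : ℕ, atZero (μ ^ n) / n)) := by
      refine tendsto_tsum_of_dominated_convergence hA (fun n => ?_) ?_
      · simpa [returnPrimitive] using (hz1.pow n).const_mul (atZero (μ ^ n) / n)
      · filter_upwards [hev] with z hz n
        simp only [returnPrimitive, coeff_mk]
        rw [norm_mul, norm_pow, Real.norm_eq_abs, Real.norm_eq_abs, abs_of_nonneg hz.1,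
          abs_of_nonneg (div_nonneg (h.return_nonneg n) n.cast_nonneg)]
        exact mul_le_of_le_one_right (div_nonneg (h.return_nonneg n) n.cast_nonneg)
          (pow_le_one₀ hz.1 hz.2.le)
    refine Tendsto.congr' ?_ ((Real.continuous_exp.tendsto _).comp hlim.neg)
    filter_upwards [hev] with z hz
    exact (h.evalAt_scalarFactor (habs z hz)).symm
  -- From `f0² = (1 - z) b` with `b` convergent: the walk leaves the half-line almost surely.
  have hf0lim : Tendsto f0 (𝓝[<] 1) (𝓝 0) := by
    have : Tendsto (fun z => f0 z ^ 2) (𝓝[<] 1) (𝓝 0) := by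
      have h1 : Tendsto (fun z => (1 - z) * b z) (𝓝[<] 1)
          (𝓝 ((1 - 1) * Real.exp (-∑' n : ℕ, atZero (μ ^ n) / n))) :=
        (tendsto_const_nhds.sub hz1).mul hblim
      rw [sub_self, zero_mul] at h1
      refine h1.congr' ?_
      filter_upwards [hev] with z hz
      exact (hsq z (habs z hz)).symm
    have h2 := (Real.continuous_sqrt.tendsto _).comp this
    simp only [Function.comp_def, Real.sqrt_sq_eq_abs, Real.sqrt_zero] at h2
    exact (tendsto_zero_iff_abs_tendsto_zero _).2 h2
  have hf1lim : Tendsto f1 (𝓝[<] 1) (𝓝 m) := by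
    have h1 : Tendsto (fun z => z * m - f1 z) (𝓝[<] 1) (𝓝 0) := by
      refine squeeze_zero_norm' ?_ (by simpa using hf0lim.const_mul K)
      filter_upwards [hev] with z hz
      exact hdiff z hz.1 hz.2
    have h2 := (hz1.mul_const m).sub h1
    simpa using h2
  have hv2lim : Tendsto (fun z => v2 z * f0 z) (𝓝[<] 1) (𝓝 0) := by
    refine squeeze_zero_norm' ?_ (by simpa using (hf0lim.abs.const_mul (M ^ 2)))
    filter_upwards [hev] with z hz
    rw [norm_mul, Real.norm_eq_abs, Real.norm_eq_abs]
    exact mul_le_mul_of_nonneg_right (h.abs_evalAt_moment2_exit_le hz.1 hz.2) (abs_nonneg _)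
  -- The term `v2 * f0` vanishes in the limit, so `σ² b(1) = 2 m²` remains of the moment identity.
  have hL := (hv2lim.const_mul 2).add ((hz1.mul_const (moment2 μ)).mul hblim)
  have hR := (hf1lim.pow 2).const_mul 2
  have := tendsto_nhds_unique (hL.congr' (by
    filter_upwards [hev] with z hz
    exact hmom z (habs z hz))) hR
  rw [← this]
  ring

end

/-! ### Uniqueness in the half-space problem -/

section
variable {d : ℕ}

lemma dot_add (p : EuclideanSpace ℝ (Fin d)) (x y : Fin d → ℤ) :
    dot p (x + y) = dot p x + dot p y := by
  simp [dot, mul_add, Finset.sum_add_distrib]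

lemma dot_sub (p : EuclideanSpace ℝ (Fin d)) (x y : Fin d → ℤ) :
    dot p (x - y) = dot p x - dot p y := by
  simp [dot, mul_sub, Finset.sum_sub_distrib]

@[simp] lemma dot_zero (p : EuclideanSpace ℝ (Fin d)) : dot p 0 = 0 := by simp [dot]

@[simp] lemma dot_single (p : EuclideanSpace ℝ (Fin d)) (i : Fin d) :
    dot p (Pi.single i 1) = p i := by
  rw [dot, Finset.sum_eq_single i]
  · simp
  · intro j _ hj; simp [hj]
  · simp

/-- A bound for the size of the steps `± p i`. -/
def stepBound (p : EuclideanSpace ℝ (Fin d)) : ℝ := ∑ i, |p i|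

lemma abs_le_stepBound (p : EuclideanSpace ℝ (Fin d)) (i : Fin d) : |p i| ≤ stepBound p :=
  Finset.single_le_sum (f := fun i => |p i|) (fun _ _ => abs_nonneg _) (Finset.mem_univ i)

lemma stepBound_nonneg (p : EuclideanSpace ℝ (Fin d)) : 0 ≤ stepBound p :=
  Finset.sum_nonneg fun _ _ => abs_nonneg _

lemma sum_sq_pos {p : EuclideanSpace ℝ (Fin d)} (hp : p ≠ 0) : 0 < ∑ i, p i ^ 2 := by
  have h := EuclideanSpace.real_norm_sq_eq p
  rw [← h]
  positivity

/-- The maximum principle in a strip. -/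
lemma nonpos_of_subharmonic_strip {p : EuclideanSpace ℝ (Fin d)} (hp : p ≠ 0) {L B : ℝ}
    {f : (Fin d → ℤ) → ℝ} (hB : ∀ x, f x ≤ B)
    (hsub : ∀ x, 0 < dot p x → dot p x < L → 0 ≤ laplacian f x)
    (hout : ∀ x, ¬(0 < dot p x ∧ dot p x < L) → f x ≤ 0) (x₀ : Fin d → ℤ) : f x₀ ≤ 0 := by
  by_contra hneg
  push Not at hneg
  set M := stepBound p with hM
  have hM0 : 0 ≤ M := stepBound_nonneg p
  have hx₀ : 0 < dot p x₀ ∧ dot p x₀ < L := by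
    by_contra h
    exact absurd (hout x₀ h) (not_le.2 hneg)
  have hL : 0 < L := hx₀.1.trans hx₀.2
  -- The quadratic term makes `F` strictly subharmonic in the strip. With this `ε` it contributes at
  -- most `f x₀` at points that one step from the strip can reach.
  set ε := f x₀ / (L + M) ^ 2 with hε
  have hε0 : 0 < ε := by positivity
  have hεL : ε * (L + M) ^ 2 = f x₀ := by rw [hε]; field_simp
  set F : (Fin d → ℤ) → ℝ := fun x => f x + ε * dot p x ^ 2 with hF
  set S : Set (Fin d → ℤ) := {x | 0 < dot p x ∧ dot p x < L} with hS
  have hbdd : BddAbove (F '' S) := by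
    refine ⟨B + ε * L ^ 2, ?_⟩
    rintro _ ⟨x, hx, rfl⟩
    have : dot p x ^ 2 ≤ L ^ 2 := by
      have := hx.1
      have := hx.2
      gcongr
    exact add_le_add (hB x) (by gcongr)
  set σ := sSup (F '' S) with hσ
  have hσ₀ : f x₀ ≤ σ := le_trans (by simp only [hF]; nlinarith [sq_nonneg (dot p x₀)])
    (le_csSup hbdd ⟨x₀, hx₀, rfl⟩)
  have hle : ∀ y, -M ≤ dot p y → dot p y ≤ L + M → F y ≤ σ := by
    intro y h1 h2
    by_cases hy : y ∈ S
    · exact le_csSup hbdd ⟨y, hy, rfl⟩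
    · have h3 := hout y hy
      have h4 : dot p y ^ 2 ≤ (L + M) ^ 2 := sq_le_sq' (by linarith) h2
      have h5 : ε * dot p y ^ 2 ≤ ε * (L + M) ^ 2 := by gcongr
      simp only [hF]
      linarith
  have hp2 := sum_sq_pos hp
  set q := ∑ i, p i ^ 2 with hq
  -- The strip is infinite and the supremum need not be attained. A point within `ε q / (d + 1)` of
  -- it suffices, since `2d` such deficits stay below the gain `2 ε q` in the Laplacian.
  obtain ⟨_, ⟨x, hx, rfl⟩, hxσ⟩ := exists_lt_of_lt_csSup (Set.Nonempty.image F ⟨x₀, hx₀⟩)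
    (show σ - ε * q / (d + 1) < σ by
      have : 0 < ε * q / (d + 1) := by positivity
      linarith)
  have hlapF : laplacian F x = laplacian f x + 2 * ε * q := by
    simp only [laplacian, hF, dot_add, dot_sub, dot_single]
    rw [hq, Finset.mul_sum, ← Finset.sum_add_distrib]
    exact Finset.sum_congr rfl fun i _ => by ring
  have hupper : laplacian F x ≤ ∑ _i : Fin d, 2 * (ε * q / (d + 1)) := by
    refine Finset.sum_le_sum fun i _ => ?_
    have hi := abs_le.1 (abs_le_stepBound p i)
    have h1 := hle (x + Pi.single i 1) (by rw [dot_add, dot_single]; linarith [hx.1, hi.1])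
      (by rw [dot_add, dot_single]; linarith [hx.2, hi.2])
    have h2 := hle (x - Pi.single i 1) (by rw [dot_sub, dot_single]; linarith [hx.1, hi.2])
      (by rw [dot_sub, dot_single]; linarith [hx.2, hi.1])
    linarith
  rw [Finset.sum_const, Finset.card_univ, Fintype.card_fin, nsmul_eq_mul] at hupper
  have h1 := hsub x hx.1 hx.2
  have h2 : (d : ℝ) * (2 * (ε * q / (d + 1))) < 2 * ε * q := by
    have : (d : ℝ) / (d + 1) < 1 := by rw [div_lt_one (by positivity)]; linarith
    have h3 : (d : ℝ) * (2 * (ε * q / (d + 1))) = (d : ℝ) / (d + 1) * (2 * ε * q) := by ring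
    rw [h3]
    exact mul_lt_of_lt_one_left (by positivity) this
  linarith

/-- A bounded function which vanishes outside a half-space and is harmonic in it is nonpositive. -/
lemma nonpos_of_harmonic_halfSpace {p : EuclideanSpace ℝ (Fin d)} (hp : p ≠ 0) {B : ℝ}
    {w : (Fin d → ℤ) → ℝ} (hB : ∀ x, w x ≤ B) (hharm : ∀ x, 0 < dot p x → laplacian w x = 0)
    (hzero : ∀ x, dot p x ≤ 0 → w x = 0) (x : Fin d → ℤ) : w x ≤ 0 := by
  have hB0 : 0 ≤ B := (hzero 0 (by simp)).symm.le.trans (hB 0)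
  set M := stepBound p with hM
  -- Comparison with an affine barrier of slope `B / L`, then `L → ∞`. The shift by `M` keeps the
  -- truncation inactive at points of the half-space and their neighbours.
  have key : ∀ L, 0 < L → w x ≤ B * max (dot p x + M) 0 / L := by
    intro L hL
    have := nonpos_of_subharmonic_strip hp (L := L) (B := B)
      (f := fun x => w x - B / L * max (dot p x + M) 0) (fun y => by
        have : 0 ≤ B / L * max (dot p y + M) 0 := by positivity
        linarith [hB y]) (fun y hy _ => by
        have : laplacian (fun x => w x - B / L * max (dot p x + M) 0) y = laplacian w y := by
          simp only [laplacian]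
          refine Finset.sum_congr rfl fun i _ => ?_
          have hi := abs_le.1 (abs_le_stepBound p i)
          have h0 := stepBound_nonneg p
          rw [dot_add, dot_sub, dot_single, max_eq_left, max_eq_left, max_eq_left]
          · ring
          all_goals linarith [hi.1, hi.2]
        rw [this, hharm y hy]) (fun y hy => by
        rcases le_or_gt (dot p y) 0 with h | h
        · rw [hzero y h]
          have : 0 ≤ B / L * max (dot p y + M) 0 := by positivity
          linarith
        · have h2 : L ≤ dot p y := by
            by_contra h3
            exact hy ⟨h, not_le.1 h3⟩
          have h3 : L ≤ max (dot p y + M) 0 :=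
            le_max_of_le_left (by linarith [stepBound_nonneg p])
          have h4 : B / L * L ≤ B / L * max (dot p y + M) 0 := by gcongr
          rw [div_mul_cancel₀ _ hL.ne'] at h4
          linarith [hB y]) x
    rw [mul_div_right_comm]
    linarith
  have hlim : Tendsto (fun L : ℝ => B * max (dot p x + M) 0 / L) atTop (𝓝 0) :=
    tendsto_const_nhds.div_atTop tendsto_id
  exact ge_of_tendsto hlim ((eventually_gt_atTop 0).mono key)

lemma laplacian_sub (u v : (Fin d → ℤ) → ℝ) (x : Fin d → ℤ) :
    laplacian (u - v) x = laplacian u x - laplacian v x := by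
  simp only [laplacian, Pi.sub_apply, ← Finset.sum_sub_distrib]
  exact Finset.sum_congr rfl fun i _ => by ring

lemma IsHalfSpaceSolution.le {p : EuclideanSpace ℝ (Fin d)} (hp : p ≠ 0)
    {u v : (Fin d → ℤ) → ℝ} (hu : IsHalfSpaceSolution p u) (hv : IsHalfSpaceSolution p v) :
    u ≤ v := by
  obtain ⟨K, hK⟩ := hu.bounded
  obtain ⟨K', hK'⟩ := hv.bounded
  intro x
  have := nonpos_of_harmonic_halfSpace hp (w := u - v) (B := max (K + K') 0) (fun y => by
    rcases le_or_gt (dot p y) 0 with h | h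
    · simp [hu.zero y h, hv.zero y h]
    · have h1 := abs_le.1 (hK y h)
      have h2 := abs_le.1 (hK' y h)
      refine le_max_of_le_left ?_
      simp only [Pi.sub_apply]
      linarith [h1.2, h2.1]) (fun y hy => by
      rw [laplacian_sub, hu.harmonic y hy, hv.harmonic y hy, sub_zero]) (fun y hy => by
      simp [hu.zero y hy, hv.zero y hy]) x
  simpa using this

lemma IsHalfSpaceSolution.unique {p : EuclideanSpace ℝ (Fin d)} (hp : p ≠ 0)
    {u v : (Fin d → ℤ) → ℝ} (hu : IsHalfSpaceSolution p u) (hv : IsHalfSpaceSolution p v) :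
    u = v :=
  le_antisymm (hu.le hp hv) (hv.le hp hu)

/-! ### Existence in the half-space problem -/

/-- The law of one step of the projection to the line, along `p`, of the simple random walk. -/
def lineStep (p : EuclideanSpace ℝ (Fin d)) : LineAlgebra :=
  ∑ i, (AddMonoidAlgebra.single (p i) (1 / (2 * (d : ℝ)))
    + AddMonoidAlgebra.single (-p i) (1 / (2 * (d : ℝ))))

lemma pairing_lineStep (p : EuclideanSpace ℝ (Fin d)) (g : ℝ → ℝ) :
    pairing g (lineStep p) = 1 / (2 * (d : ℝ)) * ∑ i, (g (p i) + g (-p i)) := by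
  simp only [lineStep, map_sum, map_add, pairing_single, ← mul_add, Finset.mul_sum]

lemma pairing_lineStep_mono (p : EuclideanSpace ℝ (Fin d)) {g g' : ℝ → ℝ}
    (h : ∀ s, |s| ≤ stepBound p → g s ≤ g' s) :
    pairing g (lineStep p) ≤ pairing g' (lineStep p) := by
  rw [pairing_lineStep, pairing_lineStep]
  refine mul_le_mul_of_nonneg_left (Finset.sum_le_sum fun i _ => ?_) (by positivity)
  exact add_le_add (h _ (abs_le_stepBound p i)) (h _ ((abs_neg _).trans_le (abs_le_stepBound p i)))

lemma pairing_lineStep_affine (hd : 0 < d) (p : EuclideanSpace ℝ (Fin d)) (c : ℝ) :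
    pairing (fun s => s + c) (lineStep p) = c := by
  have : (0 : ℝ) < d := by exact_mod_cast hd
  rw [pairing_lineStep]
  have : ∀ i, p i + c + (-p i + c) = 2 * c := fun i => by ring
  simp only [this, Finset.sum_const, Finset.card_univ, Fintype.card_fin, nsmul_eq_mul]
  field_simp

lemma isSymmStep_lineStep (hd : 0 < d) (p : EuclideanSpace ℝ (Fin d)) :
    IsSymmStep (lineStep p) (stepBound p) where
  nonneg := by
    intro t
    simp only [lineStep, AddMonoidAlgebra.coeff_sum, AddMonoidAlgebra.coeff_add,
      AddMonoidAlgebra.coeff_single, Finsupp.finsetSum_apply, Finsupp.add_apply,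
      Finsupp.single_apply]
    refine Finset.sum_nonneg fun i _ => ?_
    positivity
  mass_eq := by
    have : (0 : ℝ) < d := by exact_mod_cast hd
    rw [mass, pairing_lineStep]
    simp only [Finset.sum_const, Finset.card_univ, Fintype.card_fin, nsmul_eq_mul]
    field_simp
    norm_num
  symm := by
    simp only [lineStep, map_sum, map_add, reflect_single, neg_neg]
    exact Finset.sum_congr rfl fun i _ => add_comm _ _
  supp := by
    have hs : ∀ s c : ℝ, |s| ≤ stepBound p →
        SuppIn (Set.Icc (-stepBound p) (stepBound p)) (AddMonoidAlgebra.single s c) := by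
      intro s c hs t ht
      rw [AddMonoidAlgebra.coeff_single, Finsupp.single_apply] at ht
      split_ifs at ht with h
      · rw [← h]; exact abs_le.1 hs
      · exact absurd rfl ht
    exact SuppIn.sum fun i _ => (hs _ _ (abs_le_stepBound p i)).add
      (hs _ _ ((abs_neg _).trans_le (abs_le_stepBound p i)))

lemma moment2_lineStep (p : EuclideanSpace ℝ (Fin d)) :
    moment2 (lineStep p) = ‖p‖ ^ 2 / d := by
  rw [moment2, pairing_lineStep, EuclideanSpace.real_norm_sq_eq]
  simp only [neg_sq, ← two_mul, ← Finset.mul_sum]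
  ring

/-- Monotone iteration towards the half-line solution. -/
def lineIter (p : EuclideanSpace ℝ (Fin d)) : ℕ → ℝ → ℝ
  | 0, t => max t 0
  | n + 1, t => if 0 < t then pairing (fun s => lineIter p n (s + t)) (lineStep p) else 0

/-- The affine function `t` is harmonic for the centred step and lies below `max t 0`, so the first
iteration can only increase the starting function. -/
lemma le_lineIter (hd : 0 < d) (p : EuclideanSpace ℝ (Fin d)) (n : ℕ) (t : ℝ) :
    lineIter p 0 t ≤ lineIter p n t := by
  induction n generalizing t with
  | zero => exact le_rfl
  | succ n ih =>
    rw [lineIter, lineIter]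
    split_ifs with ht
    · rw [max_eq_left ht.le]
      conv_lhs => rw [← pairing_lineStep_affine hd p t]
      exact pairing_lineStep_mono p fun s _ => (le_max_left _ _).trans (ih _)
    · exact max_le (not_lt.1 ht) le_rfl

lemma lineIter_le_succ (hd : 0 < d) (p : EuclideanSpace ℝ (Fin d)) (n : ℕ) (t : ℝ) :
    lineIter p n t ≤ lineIter p (n + 1) t := by
  induction n generalizing t with
  | zero => exact le_lineIter hd p 1 t
  | succ n ih =>
    rw [lineIter, lineIter]
    split_ifs
    · exact pairing_lineStep_mono p fun s _ => ih _
    · exact le_rfl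

lemma lineIter_of_nonpos (p : EuclideanSpace ℝ (Fin d)) (n : ℕ) {t : ℝ} (ht : t ≤ 0) :
    lineIter p n t = 0 := by
  cases n with
  | zero => exact max_eq_right ht
  | succ n => exact if_neg ht.not_gt

/-- The barrier `t + stepBound p` is harmonic and nonnegative on `[-stepBound p, ∞)`, where every
step from `(0, ∞)` lands. -/
lemma lineIter_le (hd : 0 < d) (p : EuclideanSpace ℝ (Fin d)) (n : ℕ) {t : ℝ}
    (ht : -stepBound p ≤ t) : lineIter p n t ≤ t + stepBound p := by
  have hM := stepBound_nonneg p
  induction n generalizing t with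
  | zero => exact max_le (by linarith) (by linarith)
  | succ n ih =>
    rw [lineIter]
    split_ifs with h
    · rw [← pairing_lineStep_affine hd p (t + stepBound p)]
      refine pairing_lineStep_mono p fun s hs => ?_
      rw [← add_assoc]
      exact ih (by linarith [(abs_le.1 hs).1])
    · linarith

/-- The half-line solution. -/
lemma exists_line_solution (hd : 0 < d) (p : EuclideanSpace ℝ (Fin d)) :
    ∃ g : ℝ → ℝ, (∀ t ≤ 0, g t = 0) ∧
      (∀ t, 0 < t → pairing (fun s => g (s + t)) (lineStep p) = g t) ∧
      (∀ t, 0 ≤ t → |g t - t| ≤ stepBound p) ∧ ∀ t, 0 ≤ g t := by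
  have hM := stepBound_nonneg p
  have hmono : ∀ t, Monotone fun n => lineIter p n t := fun t =>
    monotone_nat_of_le_succ fun n => lineIter_le_succ hd p n t
  have hbdd : ∀ t, BddAbove (Set.range fun n => lineIter p n t) := by
    intro t
    rcases le_or_gt t 0 with ht | ht
    · exact ⟨0, by rintro _ ⟨n, rfl⟩; exact (lineIter_of_nonpos p n ht).le⟩
    · exact ⟨t + stepBound p, by rintro _ ⟨n, rfl⟩; exact lineIter_le hd p n (by linarith)⟩
  have hlim : ∀ t, Tendsto (fun n => lineIter p n t) atTop (𝓝 (⨆ n, lineIter p n t)) :=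
    fun t => tendsto_atTop_ciSup (hmono t) (hbdd t)
  refine ⟨fun t => ⨆ n, lineIter p n t, fun t ht => ?_, fun t ht => ?_, fun t ht => ?_,
    fun t => ?_⟩
  · simp [lineIter_of_nonpos p _ ht]
  · have h1 := (tendsto_add_atTop_iff_nat 1).2 (hlim t)
    have h2 : Tendsto (fun n => lineIter p (n + 1) t) atTop
        (𝓝 (pairing (fun s => ⨆ n, lineIter p n (s + t)) (lineStep p))) := by
      simp only [lineIter, if_pos ht, pairing_apply]
      exact tendsto_finsetSum _ fun s _ => (hlim _).const_mul _
    exact tendsto_nhds_unique h2 h1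
  · have h1 : t ≤ ⨆ n, lineIter p n t := (le_max_left t 0).trans (le_ciSup (hbdd t) 0)
    have h2 : ⨆ n, lineIter p n t ≤ t + stepBound p :=
      ciSup_le fun n => lineIter_le hd p n (by linarith)
    rw [abs_le]
    constructor <;> linarith
  · exact (le_max_right t 0).trans (le_ciSup (hbdd t) 0)

/-! ### From the line back to the lattice, and the formula for the Hamiltonian. -/

lemma laplacian_comp_dot (hd : 0 < d) (p : EuclideanSpace ℝ (Fin d)) (g : ℝ → ℝ)
    (x : Fin d → ℤ) : laplacian (fun y => g (dot p y)) x
      = 2 * d * (pairing (fun s => g (s + dot p x)) (lineStep p) - g (dot p x)) := by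
  have : (0 : ℝ) < d := by exact_mod_cast hd
  rw [pairing_lineStep]
  simp only [laplacian, dot_add, dot_sub, dot_single, Finset.sum_sub_distrib, Finset.sum_const,
    Finset.card_univ, Fintype.card_fin, nsmul_eq_mul]
  have e : ∀ i, g (p i + dot p x) + g (-p i + dot p x)
      = g (dot p x + p i) + g (dot p x - p i) := fun i => by
    rw [add_comm, add_comm (-p i), ← sub_eq_add_neg, add_comm, add_comm (p i)]
  simp only [e]
  field_simp

lemma dim_pos {p : EuclideanSpace ℝ (Fin d)} (hp : p ≠ 0) : 0 < d := by
  rcases d.eq_zero_or_pos with rfl | h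
  · exact absurd (Subsingleton.elim p 0) hp
  · exact h

lemma isHalfSpaceSolution_comp_dot (hd : 0 < d) {p : EuclideanSpace ℝ (Fin d)} {g : ℝ → ℝ}
    (h0 : ∀ t ≤ 0, g t = 0)
    (hharm : ∀ t, 0 < t → pairing (fun s => g (s + t)) (lineStep p) = g t) {K : ℝ}
    (hK : ∀ t, 0 ≤ t → |g t - t| ≤ K) : IsHalfSpaceSolution p fun x => g (dot p x) where
  harmonic x hx := by rw [laplacian_comp_dot hd, hharm _ hx, sub_self, mul_zero]
  zero x hx := h0 _ hx
  bounded := ⟨K, fun x hx => hK _ hx.le⟩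

theorem existsUnique_isHalfSpaceSolution {p : EuclideanSpace ℝ (Fin d)} (hp : p ≠ 0) :
    ∃! u : (Fin d → ℤ) → ℝ, IsHalfSpaceSolution p u := by
  obtain ⟨g, h0, hharm, hK, -⟩ := exists_line_solution (dim_pos hp) p
  have hsol := isHalfSpaceSolution_comp_dot (dim_pos hp) h0 hharm hK
  exact ⟨_, hsol, fun v hv => hv.unique hp hsol⟩

lemma H_eq_laplacian {p : EuclideanSpace ℝ (Fin d)} (hp : p ≠ 0) {u : (Fin d → ℤ) → ℝ}
    (hu : IsHalfSpaceSolution p u) : H p = laplacian u 0 := by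
  have h : ∃ u, IsHalfSpaceSolution p u := ⟨u, hu⟩
  rw [H, dif_pos h, h.choose_spec.unique hp hu]

/-- The return probabilities of the projected walk. -/
def returnProb (p : EuclideanSpace ℝ (Fin d)) (n : ℕ) : ℝ := atZero (lineStep p ^ n)

/-- The formula for the Hamiltonian. -/
theorem H_eq {p : EuclideanSpace ℝ (Fin d)} (hp : p ≠ 0)
    (hA : Summable fun n : ℕ => returnProb p n / n) :
    H p = ‖p‖ * Real.sqrt (2 * d) * Real.exp (-(∑' n : ℕ, returnProb p n / n) / 2) := by
  have hd := dim_pos hp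
  have hd' : (0 : ℝ) < d := by exact_mod_cast hd
  obtain ⟨g, h0, hharm, hK, hnn⟩ := exists_line_solution hd p
  have hH : H p = 2 * d * pairing g (lineStep p) := by
    rw [H_eq_laplacian hp (isHalfSpaceSolution_comp_dot hd h0 hharm hK), laplacian_comp_dot hd]
    simp [h0]
  have hsq := (isSymmStep_lineStep hd p).sq_mean_harmonic hA h0 hharm hK
  -- The limit identity determines only the square of the mean; `g ≥ 0` selects the root.
  have hpos : 0 ≤ pairing g (lineStep p) :=
    (isSymmStep_lineStep hd p).nonneg.pairing_nonneg fun t _ => hnn t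
  rw [moment2_lineStep] at hsq
  rw [hH, ← sq_eq_sq₀ (by positivity) (by positivity), mul_pow, mul_pow, mul_pow, mul_pow,
    Real.sq_sqrt (by positivity), ← Real.exp_nat_mul]
  have e : ((2 : ℕ) : ℝ) * (-(∑' n : ℕ, returnProb p n / n) / 2)
      = -∑' n : ℕ, atZero (lineStep p ^ n) / n := by
    push_cast
    unfold returnProb
    ring
  rw [e]
  field_simp at hsq ⊢
  linear_combination hsq

end

/-! ### Decay of the return probabilities -/

/-- The factor `2n + 1` lets the induction close, through `4 (2n+1)(2n+3) ≤ 16 (n+1)²`. -/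
lemma centralBinom_sq_mul_le (n : ℕ) : n.centralBinom ^ 2 * (2 * n + 1) ≤ 16 ^ n := by
  induction n with
  | zero => simp
  | succ n ih =>
    have h := Nat.succ_mul_centralBinom_succ n
    have h2 : (n + 1) ^ 2 * ((n + 1).centralBinom ^ 2 * (2 * (n + 1) + 1))
        ≤ (n + 1) ^ 2 * 16 ^ (n + 1) := by
      calc (n + 1) ^ 2 * ((n + 1).centralBinom ^ 2 * (2 * (n + 1) + 1))
          = ((n + 1) * (n + 1).centralBinom) ^ 2 * (2 * n + 3) := by ring
        _ = (n.centralBinom ^ 2 * (2 * n + 1)) * (4 * (2 * n + 1) * (2 * n + 3)) := by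
            rw [h]; ring
        _ ≤ 16 ^ n * (16 * (n + 1) ^ 2) := by
            refine Nat.mul_le_mul ih ?_
            nlinarith
        _ = (n + 1) ^ 2 * 16 ^ (n + 1) := by ring
    exact Nat.le_of_mul_le_mul_left h2 (by positivity)

lemma choose_half_sq_mul_le (k : ℕ) : (k.choose (k / 2)) ^ 2 * (k + 1) ≤ 4 ^ k := by
  rcases Nat.even_or_odd' k with ⟨m, rfl | rfl⟩
  · rw [Nat.mul_div_cancel_left m two_pos, ← Nat.centralBinom_eq_two_mul_choose, pow_mul]
    exact centralBinom_sq_mul_le m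
  · have h1 : (2 * m + 1) / 2 = m := by omega
    rw [h1]
    -- The two middle entries of an odd row are equal and add up to the central entry of the next
    -- row.
    have h2 : (m + 1).centralBinom = 2 * (2 * m + 1).choose m := by
      rw [Nat.centralBinom_eq_two_mul_choose, show 2 * (m + 1) = (2 * m + 1) + 1 by ring,
        Nat.choose_succ_succ, Nat.choose_symm_half]
      ring
    have h3 := centralBinom_sq_mul_le (m + 1)
    rw [h2] at h3
    have h4 : 4 * ((2 * m + 1).choose m ^ 2 * (2 * m + 1 + 1)) ≤ 4 * 4 ^ (2 * m + 1) := by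
      calc 4 * ((2 * m + 1).choose m ^ 2 * (2 * m + 1 + 1))
          ≤ (2 * (2 * m + 1).choose m) ^ 2 * (2 * (m + 1) + 1) := by
            rw [mul_pow]
            nlinarith [Nat.zero_le ((2 * m + 1).choose m ^ 2)]
        _ ≤ 16 ^ (m + 1) := h3
        _ = 4 * 4 ^ (2 * m + 1) := by
            rw [show (16 : ℕ) = 4 ^ 2 by norm_num, ← pow_mul]; ring
    exact Nat.le_of_mul_le_mul_left h4 (by norm_num)

lemma choose_half_le (k : ℕ) : ((k.choose (k / 2) : ℕ) : ℝ) ≤ 2 ^ k / Real.sqrt (k + 1) := by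
  have h : ((k.choose (k / 2) : ℕ) : ℝ) ^ 2 * (k + 1) ≤ 4 ^ k := by
    exact_mod_cast choose_half_sq_mul_le k
  rw [le_div_iff₀ (by positivity)]
  refine (pow_le_pow_iff_left₀ (by positivity) (by positivity) two_ne_zero).1 ?_
  rw [mul_pow, Real.sq_sqrt (by positivity), ← pow_mul, mul_comm k, pow_mul]
  norm_num
  exact h

/-- The coefficients of the powers of a symmetric two-point measure. -/
lemma coeff_pow_two_point_le {a w : ℝ} (ha : a ≠ 0) (hw : 0 ≤ w) (k : ℕ) (t : ℝ) :
    ((AddMonoidAlgebra.single a w + AddMonoidAlgebra.single (-a) w) ^ k :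
      LineAlgebra).coeff t ≤ (2 * w) ^ k / Real.sqrt (k + 1) := by
  have hform : ∀ j ∈ Finset.range (k + 1), ((AddMonoidAlgebra.single a w ^ j
      * AddMonoidAlgebra.single (-a) w ^ (k - j) * (k.choose j : LineAlgebra) :
      LineAlgebra)).coeff t
      = if (2 * (j : ℝ) - k) * a = t then w ^ k * k.choose j else 0 := by
    intro j hj
    have hjk : j ≤ k := Nat.lt_succ_iff.1 (Finset.mem_range.1 hj)
    rw [AddMonoidAlgebra.single_pow, AddMonoidAlgebra.single_pow,
      AddMonoidAlgebra.single_mul_single, AddMonoidAlgebra.natCast_def,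
      AddMonoidAlgebra.single_mul_single, AddMonoidAlgebra.coeff_single, Finsupp.single_apply,
      ← pow_add, Nat.add_sub_cancel' hjk]
    have : j • a + (k - j) • -a + 0 = (2 * (j : ℝ) - k) * a := by
      simp only [nsmul_eq_mul, Nat.cast_sub hjk]
      ring
    rw [this]
  have hsum : ((AddMonoidAlgebra.single a w + AddMonoidAlgebra.single (-a) w) ^ k :
      LineAlgebra).coeff t
      = ∑ j ∈ Finset.range (k + 1), if (2 * (j : ℝ) - k) * a = t then w ^ k * k.choose j else 0 := by
    rw [add_pow, AddMonoidAlgebra.coeff_sum, Finsupp.finsetSum_apply]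
    exact Finset.sum_congr rfl hform
  have hb : w ^ k * (k.choose (k / 2) : ℕ) ≤ (2 * w) ^ k / Real.sqrt (k + 1) := by
    calc w ^ k * (k.choose (k / 2) : ℕ) ≤ w ^ k * (2 ^ k / Real.sqrt (k + 1)) :=
          mul_le_mul_of_nonneg_left (choose_half_le k) (by positivity)
      _ = (2 * w) ^ k / Real.sqrt (k + 1) := by rw [mul_pow]; ring
  rw [hsum]
  -- As `a ≠ 0`, the positions `(2j - k) a` are distinct, so at most one `j` contributes.
  by_cases hex : ∃ j ∈ Finset.range (k + 1), (2 * (j : ℝ) - k) * a = t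
  · obtain ⟨j, hj, hjt⟩ := hex
    rw [Finset.sum_eq_single_of_mem j hj fun i _ hij => if_neg fun hit => hij (by
      have := mul_right_cancel₀ ha (hit.trans hjt.symm)
      exact_mod_cast (by linarith : (i : ℝ) = j)), if_pos hjt]
    refine le_trans ?_ hb
    refine mul_le_mul_of_nonneg_left ?_ (by positivity)
    exact_mod_cast Nat.choose_le_middle j k
  · push Not at hex
    rw [Finset.sum_eq_zero fun j hj => if_neg (hex j hj)]
    positivity

lemma atZero_mul (f g : LineAlgebra) : atZero (f * g) = pairing (fun t => f.coeff (-t)) g := by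
  induction g using AddMonoidAlgebra.induction_linear with
  | zero => simp
  | add a b ha hb => rw [mul_add, map_add, map_add, ha, hb]
  | single s c =>
    rw [mul_comm, atZero, pairing_single_mul, pairing_single, pairing_apply]
    congr 1
    rw [Finset.sum_eq_single (-s)]
    · simp
    · intro t _ ht
      rw [Pi.single_eq_of_ne, mul_zero]
      intro h
      exact ht (by linarith)
    · intro h
      rw [Finsupp.notMem_support_iff.1 h, zero_mul]

lemma atZero_mul_le {f g : LineAlgebra} (hg : NonnegCoeff g) {B : ℝ}
    (hf : ∀ t, f.coeff t ≤ B) : atZero (f * g) ≤ B * mass g := by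
  rw [atZero_mul, pairing_apply, pairing_apply, Finset.mul_sum]
  refine Finset.sum_le_sum fun t _ => ?_
  rw [mul_one, mul_comm]
  exact mul_le_mul_of_nonneg_right (hf _) (hg t)

/-- This is the mean of `1/(K+1)` for `K` binomial. Absorbing `k + 1` into the binomial coefficient
turns the sum into part of the expansion of `(q + (1 - q))^(n+1)`. -/
lemma sum_binomial_div_le {q : ℝ} (hq : 0 < q) (hq1 : q ≤ 1) (n : ℕ) :
    ∑ k ∈ Finset.range (n + 1), q ^ k * (1 - q) ^ (n - k) * n.choose k / (k + 1)
      ≤ 1 / (q * (n + 1)) := by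
  have hn : (0 : ℝ) < n + 1 := by positivity
  have e : ∀ k ∈ Finset.range (n + 1), q ^ k * (1 - q) ^ (n - k) * n.choose k / (k + 1)
      = 1 / (q * (n + 1)) * (q ^ (k + 1) * (1 - q) ^ (n + 1 - (k + 1)) * (n + 1).choose (k + 1)) := by
    intro k _
    have h : ((n + 1 : ℕ) : ℝ) * n.choose k = (n + 1).choose (k + 1) * ((k + 1 : ℕ) : ℝ) := by
      exact_mod_cast Nat.add_one_mul_choose_eq n k
    push_cast at h
    rw [Nat.add_sub_add_right, pow_succ]
    field_simp
    linear_combination (1 - q) ^ (n - k) * h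
  rw [Finset.sum_congr rfl e, ← Finset.mul_sum]
  refine mul_le_of_le_one_right (by positivity) ?_
  have hb := add_pow q (1 - q) (n + 1)
  rw [Finset.sum_range_succ'] at hb
  rw [add_sub_cancel, one_pow] at hb
  have h0 : 0 ≤ q ^ 0 * (1 - q) ^ (n + 1 - 0) * ((n + 1).choose 0 : ℝ) := by
    have : 0 ≤ 1 - q := by linarith
    positivity
  linarith

/-- Choose `i` with `p i ≠ 0`. Given that `k` of the `n` steps use `± p i`, and given the other
steps, a return forces one value of the `i`-part, which has probability at most `1/√(k+1)`.
Averaging over `k`, binomial with parameter `1/d`, gives a bound uniform in `p`. -/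
theorem returnProb_le {d : ℕ} {p : EuclideanSpace ℝ (Fin d)} (hp : p ≠ 0) (n : ℕ) :
    returnProb p n ≤ d / Real.sqrt (n + 1) := by
  have hd := dim_pos hp
  have hd1 : (1 : ℝ) ≤ d := by exact_mod_cast hd
  have hd0 : (0 : ℝ) < d := by linarith
  obtain ⟨i, hi⟩ : ∃ i, p i ≠ 0 := by
    by_contra h
    push Not at h
    exact hp (by ext i; simpa using h i)
  set w : ℝ := 1 / (2 * d) with hw
  have hw0 : 0 ≤ w := by positivity
  set β : LineAlgebra := AddMonoidAlgebra.single (p i) w + AddMonoidAlgebra.single (-p i) w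
    with hβ
  set ν : LineAlgebra := ∑ j ∈ Finset.univ.erase i,
    (AddMonoidAlgebra.single (p j) w + AddMonoidAlgebra.single (-p j) w) with hν
  have hsplit : lineStep p = β + ν := by
    rw [lineStep, hβ, hν, ← Finset.add_sum_erase _ _ (Finset.mem_univ i)]
  have hνnn : NonnegCoeff ν := by
    intro t
    simp only [hν, AddMonoidAlgebra.coeff_sum, AddMonoidAlgebra.coeff_add,
      AddMonoidAlgebra.coeff_single, Finsupp.finsetSum_apply, Finsupp.add_apply,
      Finsupp.single_apply]
    refine Finset.sum_nonneg fun j _ => ?_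
    positivity
  set q : ℝ := 1 / d with hq
  have hq0 : 0 < q := by positivity
  have hq1 : q ≤ 1 := by rw [hq, div_le_one hd0]; exact hd1
  have hwq : 2 * w = q := by rw [hw, hq]; field_simp
  have hνmass : mass ν = 1 - q := by
    have h1 := (isSymmStep_lineStep hd p).mass_eq
    rw [hsplit, map_add] at h1
    have h2 : mass β = q := by
      rw [hβ, map_add, mass, pairing_single, pairing_single, ← hwq]; ring
    linarith
  have hbound : returnProb p n ≤ ∑ k ∈ Finset.range (n + 1),
      q ^ k * (1 - q) ^ (n - k) * n.choose k * (1 / Real.sqrt (k + 1)) := by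
    rw [returnProb, hsplit, add_pow, map_sum]
    refine Finset.sum_le_sum fun k _ => ?_
    have e : β ^ k * ν ^ (n - k) * (n.choose k : LineAlgebra)
        = (n.choose k : ℝ) • (β ^ k * ν ^ (n - k)) := by
      rw [Algebra.smul_def, map_natCast, mul_comm]
    rw [e, map_smul, smul_eq_mul]
    have h1 := atZero_mul_le (hνnn.pow (n - k)) (B := q ^ k / Real.sqrt (k + 1))
      (f := β ^ k) (fun t => by rw [← hwq]; exact coeff_pow_two_point_le hi hw0 k t)
    rw [mass_pow, hνmass] at h1
    calc (n.choose k : ℝ) * atZero (β ^ k * ν ^ (n - k))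
        ≤ n.choose k * (q ^ k / Real.sqrt (k + 1) * (1 - q) ^ (n - k)) := by gcongr
      _ = _ := by ring
  set s := Real.sqrt (n + 1) with hs
  have hs0 : 0 < s := by positivity
  have hs2 : s ^ 2 = n + 1 := Real.sq_sqrt (by positivity)
  -- AM–GM, balanced at `k = n`, replaces `1/√(k+1)` by `1/(k+1)`, whose binomial mean is explicit.
  have hamgm : ∀ k : ℕ, 1 / Real.sqrt (k + 1) ≤ 1 / 2 * (s * (1 / (k + 1)) + 1 / s) := by
    intro k
    set r := Real.sqrt ((k : ℝ) + 1) with hr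
    have hr0 : 0 < r := by positivity
    have hr2 : (k : ℝ) + 1 = r ^ 2 := (Real.sq_sqrt (by positivity)).symm
    rw [hr2, ← sub_nonneg]
    have : 1 / 2 * (s * (1 / r ^ 2) + 1 / s) - 1 / r = (s - r) ^ 2 / (2 * s * r ^ 2) := by
      field_simp
      ring
    rw [this]
    positivity
  have h1q : 0 ≤ 1 - q := by linarith
  calc returnProb p n ≤ ∑ k ∈ Finset.range (n + 1),
      q ^ k * (1 - q) ^ (n - k) * n.choose k * (1 / Real.sqrt (k + 1)) := hbound
    _ ≤ ∑ k ∈ Finset.range (n + 1),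
      q ^ k * (1 - q) ^ (n - k) * n.choose k * (1 / 2 * (s * (1 / (k + 1)) + 1 / s)) := by
        refine Finset.sum_le_sum fun k _ => mul_le_mul_of_nonneg_left (hamgm k) (by positivity)
    _ = s / 2 * (∑ k ∈ Finset.range (n + 1), q ^ k * (1 - q) ^ (n - k) * n.choose k / (k + 1))
        + 1 / (2 * s) * ∑ k ∈ Finset.range (n + 1), q ^ k * (1 - q) ^ (n - k) * n.choose k := by
        rw [Finset.mul_sum, Finset.mul_sum, ← Finset.sum_add_distrib]
        refine Finset.sum_congr rfl fun k _ => ?_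
        field_simp
    _ ≤ s / 2 * (1 / (q * (n + 1))) + 1 / (2 * s) * 1 := by
        rw [← add_pow, add_sub_cancel, one_pow]
        gcongr
        exact sum_binomial_div_le hq0 hq1 n
    _ = (d + 1) / 2 / s := by
        rw [← hs2, hq]
        field_simp
    _ ≤ d / s := by
        gcongr
        linarith

lemma returnProb_nonneg {d : ℕ} {p : EuclideanSpace ℝ (Fin d)} (hp : p ≠ 0) (n : ℕ) :
    0 ≤ returnProb p n := (isSymmStep_lineStep (dim_pos hp) p).return_nonneg n

/-- A summable majorant of the sequence `n ↦ returnProb p n / n`. -/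
def returnMajorant (d n : ℕ) : ℝ := d * (1 / (n : ℝ) ^ (3 / 2 : ℝ))

lemma summable_returnMajorant (d : ℕ) : Summable (returnMajorant d) :=
  (Real.summable_one_div_nat_rpow.2 (by norm_num)).mul_left _

/-- At `n = 0` both sides are `0` because division by `0` gives `0`; all these series effectively
start at `n = 1`. -/
lemma div_sqrt_div_le (d n : ℕ) : (d : ℝ) / Real.sqrt (n + 1) / n ≤ returnMajorant d n := by
  rcases n.eq_zero_or_pos with rfl | hn
  · simp [returnMajorant]
  · have hn' : (0 : ℝ) < n := by exact_mod_cast hn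
    have h1 : (n : ℝ) ^ (3 / 2 : ℝ) = Real.sqrt n * n := by
      rw [Real.sqrt_eq_rpow, show (3 / 2 : ℝ) = 1 / 2 + 1 by norm_num, Real.rpow_add hn',
        Real.rpow_one]
    rw [returnMajorant, h1, div_div, mul_one_div]
    gcongr
    linarith

lemma returnProb_div_le {d : ℕ} {p : EuclideanSpace ℝ (Fin d)} (hp : p ≠ 0) (n : ℕ) :
    returnProb p n / n ≤ returnMajorant d n :=
  (div_le_div_of_nonneg_right (returnProb_le hp n) n.cast_nonneg).trans (div_sqrt_div_le d n)

lemma norm_returnProb_div_le {d : ℕ} {p : EuclideanSpace ℝ (Fin d)} (hp : p ≠ 0) (n : ℕ) :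
    ‖returnProb p n / n‖ ≤ returnMajorant d n := by
  rw [Real.norm_of_nonneg (div_nonneg (returnProb_nonneg hp n) n.cast_nonneg)]
  exact returnProb_div_le hp n

lemma summable_returnProb_div {d : ℕ} {p : EuclideanSpace ℝ (Fin d)} (hp : p ≠ 0) :
    Summable fun n : ℕ => returnProb p n / n :=
  Summable.of_norm_bounded (summable_returnMajorant d) (norm_returnProb_div_le hp)

/-- The exponent in the formula for the Hamiltonian. -/
def returnSum {d : ℕ} (p : EuclideanSpace ℝ (Fin d)) : ℝ := ∑' n : ℕ, returnProb p n / n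

theorem H_eq_exp {d : ℕ} {p : EuclideanSpace ℝ (Fin d)} (hp : p ≠ 0) :
    H p = ‖p‖ * Real.sqrt (2 * d) * Real.exp (-returnSum p / 2) :=
  H_eq hp (summable_returnProb_div hp)

/-! ### The simple random walk on the lattice -/

section
variable {d : ℕ}

/-- The law of one step of the simple random walk on `ℤ^d`. -/
def latticeStep (d : ℕ) : AddMonoidAlgebra ℝ (Fin d → ℤ) :=
  ∑ i, (AddMonoidAlgebra.single (Pi.single i 1) (1 / (2 * (d : ℝ)))
    + AddMonoidAlgebra.single (-Pi.single i 1) (1 / (2 * (d : ℝ))))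

/-- The transition probabilities of the simple random walk from the origin. -/
def walkProb (n : ℕ) (x : Fin d → ℤ) : ℝ := (latticeStep d ^ n).coeff x

/-- The product with a slope, as a homomorphism. -/
def dotHom (p : EuclideanSpace ℝ (Fin d)) : (Fin d → ℤ) →+ ℝ where
  toFun := dot p
  map_zero' := dot_zero p
  map_add' := dot_add p

@[simp] lemma dotHom_apply (p : EuclideanSpace ℝ (Fin d)) (x : Fin d → ℤ) :
    dotHom p x = dot p x := rfl

lemma mapDomain_latticeStep (p : EuclideanSpace ℝ (Fin d)) :
    AddMonoidAlgebra.mapDomainRingHom ℝ (dotHom p) (latticeStep d) = lineStep p := by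
  simp only [latticeStep, lineStep, map_sum, map_add, AddMonoidAlgebra.mapDomainRingHom_apply,
    AddMonoidAlgebra.mapDomain_single, map_neg]
  simp

lemma coeff_zero_mapDomain {G : Type*} [AddMonoid G] (φ : G →+ ℝ) (f : AddMonoidAlgebra ℝ G) :
    (AddMonoidAlgebra.mapDomainRingHom ℝ φ f).coeff 0
      = ∑ x ∈ f.coeff.support, if φ x = 0 then f.coeff x else 0 := by
  conv_lhs => rw [← AddMonoidAlgebra.sum_coeff_single f]
  rw [Finsupp.sum, map_sum, AddMonoidAlgebra.coeff_sum, Finsupp.finsetSum_apply]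
  refine Finset.sum_congr rfl fun x _ => ?_
  simp [Finsupp.single_apply]

/-- Projection to the line respects convolution powers. Thus `p` enters only by selecting the points
of `Lam p` in a finite sum whose weights do not depend on `p`. -/
lemma returnProb_eq_sum (p : EuclideanSpace ℝ (Fin d)) (n : ℕ) :
    returnProb p n = ∑ x ∈ (latticeStep d ^ n).coeff.support,
      if dot p x = 0 then walkProb n x else 0 := by
  rw [returnProb, atZero_apply, ← mapDomain_latticeStep, ← map_pow, coeff_zero_mapDomain]
  rfl

lemma coeff_mul_nonneg {G : Type*} [AddMonoid G] {f g : AddMonoidAlgebra ℝ G}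
    (hf : ∀ x, 0 ≤ f.coeff x) (hg : ∀ x, 0 ≤ g.coeff x) (x : G) : 0 ≤ (f * g).coeff x := by
  classical
  rw [AddMonoidAlgebra.coeff_mul]
  refine Finset.sum_nonneg fun a _ => Finset.sum_nonneg fun b _ => ?_
  dsimp only
  split_ifs
  · exact mul_nonneg (hf a) (hg b)
  · exact le_rfl

lemma coeff_mul_pos {G : Type*} [AddMonoid G] {f g : AddMonoidAlgebra ℝ G}
    (hf : ∀ x, 0 ≤ f.coeff x) (hg : ∀ x, 0 ≤ g.coeff x) {x y : G} (hx : 0 < f.coeff x)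
    (hy : 0 < g.coeff y) : 0 < (f * g).coeff (x + y) := by
  classical
  have hterm : ∀ a b, 0 ≤ if a + b = x + y then f.coeff a * g.coeff b else 0 := by
    intro a b
    split_ifs
    · exact mul_nonneg (hf a) (hg b)
    · exact le_rfl
  rw [AddMonoidAlgebra.coeff_mul]
  refine Finset.sum_pos' (fun a _ => Finset.sum_nonneg fun b _ => hterm a b)
    ⟨x, Finsupp.mem_support_iff.2 hx.ne', Finset.sum_pos' (fun b _ => hterm x b)
      ⟨y, Finsupp.mem_support_iff.2 hy.ne', ?_⟩⟩
  dsimp only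
  rw [if_pos rfl]
  exact mul_pos hx hy

lemma latticeStep_coeff_nonneg (x : Fin d → ℤ) : 0 ≤ (latticeStep d).coeff x := by
  simp only [latticeStep, AddMonoidAlgebra.coeff_sum, AddMonoidAlgebra.coeff_add,
    AddMonoidAlgebra.coeff_single, Finsupp.finsetSum_apply, Finsupp.add_apply,
    Finsupp.single_apply]
  refine Finset.sum_nonneg fun i _ => ?_
  positivity

lemma walkProb_nonneg (n : ℕ) (x : Fin d → ℤ) : 0 ≤ walkProb n x := by
  induction n generalizing x with
  | zero =>
    rw [walkProb, pow_zero, AddMonoidAlgebra.one_def, AddMonoidAlgebra.coeff_single,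
      Finsupp.single_apply]
    split_ifs <;> norm_num
  | succ n ih =>
    rw [walkProb, pow_succ]
    exact coeff_mul_nonneg ih latticeStep_coeff_nonneg x

/-- The points that the simple random walk can reach. -/
def reachable (d : ℕ) : AddSubmonoid (Fin d → ℤ) where
  carrier := {x | ∃ n, 0 < walkProb n x}
  zero_mem' := ⟨0, by simp [walkProb, AddMonoidAlgebra.one_def]⟩
  add_mem' := by
    rintro x y ⟨n, hn⟩ ⟨m, hm⟩
    refine ⟨n + m, ?_⟩
    rw [walkProb, pow_add]
    exact coeff_mul_pos (walkProb_nonneg n) (walkProb_nonneg m) hn hm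

lemma latticeStep_coeff_pos (i : Fin d) :
    0 < (latticeStep d).coeff (Pi.single i 1) ∧ 0 < (latticeStep d).coeff (-Pi.single i 1) := by
  have hd : (0 : ℝ) < d := by exact_mod_cast i.pos
  simp only [latticeStep, AddMonoidAlgebra.coeff_sum, AddMonoidAlgebra.coeff_add,
    AddMonoidAlgebra.coeff_single, Finsupp.finsetSum_apply, Finsupp.add_apply]
  constructor
  · refine Finset.sum_pos' (fun j _ => ?_) ⟨i, Finset.mem_univ i, ?_⟩
    · simp only [Finsupp.single_apply]; positivity
    · rw [Finsupp.single_eq_same, Finsupp.single_apply]; positivity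
  · refine Finset.sum_pos' (fun j _ => ?_) ⟨i, Finset.mem_univ i, ?_⟩
    · simp only [Finsupp.single_apply]; positivity
    · rw [Finsupp.single_eq_same, Finsupp.single_apply]; positivity

lemma reachable_eq_top (x : Fin d → ℤ) : x ∈ reachable d := by
  have hx : x = ∑ i, Pi.single i (x i) := (Finset.univ_sum_single x).symm
  rw [hx]
  refine AddSubmonoid.sum_mem _ fun i _ => ?_
  have h1 : Pi.single i 1 ∈ reachable d := ⟨1, by
    rw [walkProb, pow_one]; exact (latticeStep_coeff_pos i).1⟩
  have h2 : -Pi.single i 1 ∈ reachable d := ⟨1, by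
    rw [walkProb, pow_one]; exact (latticeStep_coeff_pos i).2⟩
  obtain ⟨n, hn | hn⟩ := Int.eq_nat_or_neg (x i)
  · have : (Pi.single i (x i) : Fin d → ℤ) = n • Pi.single i 1 := by
      rw [hn, ← Pi.single_smul]; simp
    rw [this]
    exact AddSubmonoid.nsmul_mem _ h1 n
  · have : (Pi.single i (x i) : Fin d → ℤ) = n • (-Pi.single i 1) := by
      rw [hn, smul_neg, ← Pi.single_smul, ← Pi.single_neg]; simp
    rw [this]
    exact AddSubmonoid.nsmul_mem _ h2 n

/-- A positive time is needed, since the term `n = 0` of the return sum is `0`. -/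
lemma exists_walkProb_pos {x : Fin d → ℤ} (hx : x ≠ 0) : ∃ n : ℕ, n ≠ 0 ∧ 0 < walkProb n x := by
  obtain ⟨n, hn⟩ := reachable_eq_top x
  refine ⟨n, ?_, hn⟩
  rintro rfl
  rw [walkProb, pow_zero, AddMonoidAlgebra.one_def, AddMonoidAlgebra.coeff_single,
    Finsupp.single_eq_of_ne hx] at hn
  exact lt_irrefl _ hn

/-! ### The limits of the Hamiltonian at a slope -/

lemma continuous_dot (x : Fin d → ℤ) : Continuous fun p : EuclideanSpace ℝ (Fin d) => dot p x := by
  unfold dot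
  fun_prop

lemma eventually_dot_eq_zero_imp (p : EuclideanSpace ℝ (Fin d)) (s : Finset (Fin d → ℤ)) :
    ∀ᶠ q in 𝓝 p, ∀ x ∈ s, dot q x = 0 → dot p x = 0 := by
  rw [Filter.eventually_all_finset]
  intro x _
  by_cases h : dot p x = 0
  · exact Eventually.of_forall fun _ _ => h
  · filter_upwards [(continuous_dot x).continuousAt.eventually_ne h] with q hq hq0
    exact absurd hq0 hq

lemma eventually_returnProb_le (p : EuclideanSpace ℝ (Fin d)) (n : ℕ) :
    ∀ᶠ q in 𝓝 p, returnProb q n ≤ returnProb p n := by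
  filter_upwards [eventually_dot_eq_zero_imp p (latticeStep d ^ n).coeff.support] with q hq
  rw [returnProb_eq_sum, returnProb_eq_sum]
  refine Finset.sum_le_sum fun x hx => ?_
  have := walkProb_nonneg n x
  by_cases h : dot q x = 0
  · rw [if_pos h, if_pos (hq x hx h)]
  · rw [if_neg h]
    split_ifs
    · exact this
    · exact le_rfl

lemma returnProb_le_of_subset {p q : EuclideanSpace ℝ (Fin d)} (h : Lam p ⊆ Lam q) (n : ℕ) :
    returnProb p n ≤ returnProb q n := by
  rw [returnProb_eq_sum, returnProb_eq_sum]
  refine Finset.sum_le_sum fun x _ => ?_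
  have := walkProb_nonneg n x
  by_cases hx : dot p x = 0
  · rw [if_pos hx, if_pos (show dot q x = 0 from h hx)]
  · rw [if_neg hx]
    split_ifs
    · exact this
    · exact le_rfl

lemma eventually_returnProb_add_le (p : EuclideanSpace ℝ (Fin d)) (n : ℕ) {x : Fin d → ℤ}
    (hx : dot p x = 0) :
    ∀ᶠ q in 𝓝 p, dot q x ≠ 0 → returnProb q n + walkProb n x ≤ returnProb p n := by
  classical
  filter_upwards [eventually_dot_eq_zero_imp p (latticeStep d ^ n).coeff.support] with q hq hqx
  by_cases hxs : x ∈ (latticeStep d ^ n).coeff.support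
  · rw [returnProb_eq_sum, returnProb_eq_sum, ← Finset.add_sum_erase _ _ hxs,
      ← Finset.add_sum_erase _ _ hxs, if_neg hqx, if_pos hx, zero_add, add_comm]
    gcongr with y hy
    have := walkProb_nonneg n y
    by_cases h : dot q y = 0
    · rw [if_pos h, if_pos (hq y (Finset.mem_of_mem_erase hy) h)]
    · rw [if_neg h]
      split_ifs
      · exact this
      · exact le_rfl
  · have h0 : walkProb n x = 0 := Finsupp.notMem_support_iff.1 hxs
    rw [h0, add_zero, returnProb_eq_sum, returnProb_eq_sum]
    refine Finset.sum_le_sum fun y hy => ?_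
    have := walkProb_nonneg n y
    by_cases h : dot q y = 0
    · rw [if_pos h, if_pos (hq y hy h)]
    · rw [if_neg h]
      split_ifs
      · exact this
      · exact le_rfl

/-- When no relation is lost, and none is gained among the points reachable in `n` steps, the `n`-th
term is eventually constant; dominated convergence does the rest. -/
lemma tendsto_returnSum {p : EuclideanSpace ℝ (Fin d)} (hp : p ≠ 0) :
    Tendsto (returnSum (d := d)) (𝓝[{q | Lam p ⊆ Lam q}] p) (𝓝 (returnSum p)) := by
  refine tendsto_tsum_of_dominated_convergence (summable_returnMajorant d) (fun n => ?_) ?_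
  · refine tendsto_const_nhds.congr' ?_
    filter_upwards [self_mem_nhdsWithin,
      mem_nhdsWithin_of_mem_nhds (eventually_returnProb_le p n)] with q hq hq'
    rw [le_antisymm (returnProb_le_of_subset hq n) hq']
  · filter_upwards [mem_nhdsWithin_of_mem_nhds (isOpen_ne.mem_nhds hp)] with q hq n
    exact norm_returnProb_div_le hq n

theorem tendsto_H {p : EuclideanSpace ℝ (Fin d)} (hp : p ≠ 0) :
    Tendsto (H (d := d)) (𝓝[{q | Lam p ⊆ Lam q}] p) (𝓝 (H p)) := by
  rw [H_eq_exp hp]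
  have h1 : Tendsto (fun q : EuclideanSpace ℝ (Fin d) =>
      ‖q‖ * Real.sqrt (2 * d) * Real.exp (-returnSum q / 2)) (𝓝[{q | Lam p ⊆ Lam q}] p)
      (𝓝 (‖p‖ * Real.sqrt (2 * d) * Real.exp (-returnSum p / 2))) := by
    refine Tendsto.mul ?_ ((Real.continuous_exp.tendsto _).comp
      ((tendsto_returnSum hp).neg.div_const 2))
    exact tendsto_nhdsWithin_of_tendsto_nhds (continuous_norm.tendsto p) |>.mul_const _
  refine h1.congr' ?_
  filter_upwards [mem_nhdsWithin_of_mem_nhds (isOpen_ne.mem_nhds hp)] with q hq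
  exact (H_eq_exp hq).symm

/-- A relation of `p` which fails for a nearby slope decreases the return sum. -/
lemma eventually_returnSum_le {p : EuclideanSpace ℝ (Fin d)} (hp : p ≠ 0) {x : Fin d → ℤ}
    (hx : dot p x = 0) (hx0 : x ≠ 0) :
    ∃ δ > 0, ∀ᶠ q in 𝓝 p, dot q x ≠ 0 → returnSum q ≤ returnSum p - δ := by
  obtain ⟨m, hm0, hm⟩ := exists_walkProb_pos hx0
  have hm0' : (0 : ℝ) < m := by exact_mod_cast Nat.pos_of_ne_zero hm0
  set δ := walkProb m x / m with hδ
  have hδ0 : 0 < δ := div_pos hm hm0'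
  -- `D` records any excess of the terms at `q` over those at `p`. Each term vanishes near `p`, so
  -- the sum tends to `0`, while the `m`-th term loses `δ`; half of that loss survives.
  set D : ℕ → EuclideanSpace ℝ (Fin d) → ℝ :=
    fun n q => max (returnProb q n - returnProb p n) 0 / n with hD
  have hDle : ∀ q, q ≠ 0 → ∀ n, ‖D n q‖ ≤ returnMajorant d n := by
    intro q hq n
    rw [Real.norm_of_nonneg (div_nonneg (le_max_right _ _) n.cast_nonneg)]
    refine le_trans ?_ (returnProb_div_le hq n)
    have := returnProb_nonneg hp n
    exact div_le_div_of_nonneg_right (max_le (by linarith) (returnProb_nonneg hq n)) n.cast_nonneg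
  have hlim : Tendsto (fun q => ∑' n, D n q) (𝓝 p) (𝓝 0) := by
    have := tendsto_tsum_of_dominated_convergence (𝓕 := 𝓝 p) (f := fun q n => D n q)
      (g := fun _ => (0 : ℝ)) (summable_returnMajorant d) (fun n => by
        refine tendsto_const_nhds.congr' ?_
        filter_upwards [eventually_returnProb_le p n] with q hq
        simp only [hD]
        rw [max_eq_right (by linarith), zero_div]) (by
        filter_upwards [isOpen_ne.mem_nhds hp] with q hq n
        exact hDle q hq n)
    simpa using this
  refine ⟨δ / 2, by positivity, ?_⟩
  filter_upwards [hlim.eventually (gt_mem_nhds (show 0 < δ / 2 by positivity)),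
    isOpen_ne.mem_nhds hp, eventually_returnProb_add_le p m hx] with q h1 h2 h3 h4
  have h5 := h3 h4
  have hs : Summable fun n : ℕ => if n = m then δ else 0 :=
    summable_of_ne_finset_zero (s := {m}) fun n hn => if_neg (by simpa using hn)
  have hsD : Summable fun n => D n q := Summable.of_norm_bounded (summable_returnMajorant d) (hDle q h2)
  have hle : returnSum q ≤ ∑' n : ℕ, ((returnProb p n / n + D n q) - if n = m then δ else 0) := by
    refine (summable_returnProb_div h2).tsum_le_tsum (fun n => ?_)
      (((summable_returnProb_div hp).add hsD).sub hs)
    by_cases hn : n = m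
    · subst hn
      rw [if_pos rfl]
      have : 0 ≤ D n q := div_nonneg (le_max_right _ _) n.cast_nonneg
      have h6 : returnProb q n / n ≤ returnProb p n / n - δ := by
        rw [hδ, ← sub_div]
        exact div_le_div_of_nonneg_right (by linarith) n.cast_nonneg
      linarith
    · rw [if_neg hn, sub_zero]
      simp only [hD]
      rw [← add_div]
      exact div_le_div_of_nonneg_right (by linarith [le_max_left (returnProb q n - returnProb p n) 0])
        n.cast_nonneg
  rw [((summable_returnProb_div hp).add hsD).tsum_sub hs,
    (summable_returnProb_div hp).tsum_add hsD, tsum_ite_eq] at hle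
  unfold returnSum at hle ⊢
  linarith

/-- A drop `δ` of the return sum multiplies the exponential factor by at least `exp(δ/2) > 1`, and
the factor `‖q‖` is continuous. -/
lemma eventually_H_ge {p : EuclideanSpace ℝ (Fin d)} (hp : p ≠ 0) {x : Fin d → ℤ}
    (hx : dot p x = 0) (hx0 : x ≠ 0) :
    ∃ c > H p, ∀ᶠ q in 𝓝 p, dot q x ≠ 0 → c ≤ H q := by
  have hd : (0 : ℝ) < d := by exact_mod_cast dim_pos hp
  obtain ⟨δ, hδ, hev⟩ := eventually_returnSum_le hp hx hx0
  set E := Real.sqrt (2 * d) * Real.exp (-(returnSum p - δ) / 2) with hE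
  have hE0 : 0 < E := by positivity
  have hlt : H p < ‖p‖ * E := by
    rw [H_eq_exp hp, hE, mul_assoc]
    have : 0 < ‖p‖ := norm_pos_iff.2 hp
    gcongr
    linarith
  obtain ⟨c, hc1, hc2⟩ := exists_between hlt
  refine ⟨c, hc1, ?_⟩
  have hcont : Tendsto (fun q : EuclideanSpace ℝ (Fin d) => ‖q‖ * E) (𝓝 p) (𝓝 (‖p‖ * E)) :=
    (continuous_norm.tendsto p).mul_const E
  filter_upwards [hev, hcont.eventually (lt_mem_nhds hc2), isOpen_ne.mem_nhds hp] with q h1 h2 h3 h4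
  refine h2.le.trans ?_
  rw [H_eq_exp h3, hE, mul_assoc]
  have := h1 h4
  gcongr

/-- The relations of `p` are generated by finitely many of them. -/
lemma exists_finset_generators (p : EuclideanSpace ℝ (Fin d)) :
    ∃ G : Finset (Fin d → ℤ), (∀ x ∈ G, dot p x = 0) ∧
      ∀ q : EuclideanSpace ℝ (Fin d), (∀ x ∈ G, dot q x = 0) → Lam p ⊆ Lam q := by
  obtain ⟨G, hG⟩ := IsNoetherian.noetherian
    (AddSubgroup.toIntSubmodule (dotHom p).ker)
  refine ⟨G, fun x hx => ?_, fun q hq x hx => ?_⟩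
  · have : x ∈ AddSubgroup.toIntSubmodule (dotHom p).ker := by
      rw [← hG]; exact Submodule.subset_span hx
    exact this
  · have h1 : x ∈ AddSubgroup.toIntSubmodule (dotHom p).ker := hx
    rw [← hG] at h1
    have h2 : Submodule.span ℤ (G : Set (Fin d → ℤ)) ≤ AddSubgroup.toIntSubmodule (dotHom q).ker :=
      Submodule.span_le.2 fun y hy => hq y hy
    exact h2 h1

lemma exists_uniform_gap {p : EuclideanSpace ℝ (Fin d)} (hp : p ≠ 0) (G : Finset (Fin d → ℤ))
    (hG : ∀ x ∈ G, dot p x = 0) :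
    ∃ c > H p, ∀ᶠ q in 𝓝 p, ∀ x ∈ G, dot q x ≠ 0 → c ≤ H q := by
  classical
  induction G using Finset.induction_on with
  | empty => exact ⟨H p + 1, by linarith, by simp⟩
  | insert x G _ ih =>
    obtain ⟨c, hc, hev⟩ := ih fun y hy => hG y (Finset.mem_insert_of_mem hy)
    by_cases hx0 : x = 0
    · refine ⟨c, hc, ?_⟩
      filter_upwards [hev] with q hq y hy hne
      rcases Finset.mem_insert.1 hy with rfl | hy
      · exact absurd (by rw [hx0, dot_zero]) hne
      · exact hq y hy hne
    · obtain ⟨c', hc', hev'⟩ := eventually_H_ge hp (hG x (Finset.mem_insert_self x G)) hx0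
      refine ⟨min c c', lt_min hc hc', ?_⟩
      filter_upwards [hev, hev'] with q hq hq' y hy hne
      rcases Finset.mem_insert.1 hy with rfl | hy
      · exact (min_le_right _ _).trans (hq' hne)
      · exact (min_le_left _ _).trans (hq y hy hne)

/-- A slope that loses a relation of `p` loses one of finitely many generators, so one gap serves
all. If there are no such slopes nearby, the lower limit is `⊤`. -/
theorem lt_liminf_H {p : EuclideanSpace ℝ (Fin d)} (hp : p ≠ 0) :
    ((H p : ℝ) : EReal) < liminf (fun q : EuclideanSpace ℝ (Fin d) => ((H q : ℝ) : EReal))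
      (𝓝[{q | ¬ Lam p ⊆ Lam q}] p) := by
  obtain ⟨G, hG, hgen⟩ := exists_finset_generators p
  obtain ⟨c, hc, hev⟩ := exists_uniform_gap hp G hG
  refine lt_of_lt_of_le (EReal.coe_lt_coe_iff.2 hc) (le_liminf_of_le (by isBoundedDefault) ?_)
  filter_upwards [self_mem_nhdsWithin, mem_nhdsWithin_of_mem_nhds hev] with q hq hq'
  have : ∃ x ∈ G, dot q x ≠ 0 := by
    by_contra h
    push Not at h
    exact hq (hgen q h)
  obtain ⟨x, hx, hne⟩ := this
  exact EReal.coe_le_coe_iff.2 (hq' x hx hne)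

theorem not_continuousAt_H_iff {p : EuclideanSpace ℝ (Fin d)} (hp : p ≠ 0) :
    ¬ ContinuousAt (H (d := d)) p ↔ ∃ x : Fin d → ℤ, x ≠ 0 ∧ x ∈ Lam p := by
  constructor
  · intro h
    by_contra hno
    push Not at hno
    refine h ?_
    have huniv : {q : EuclideanSpace ℝ (Fin d) | Lam p ⊆ Lam q} = Set.univ := by
      ext q
      simp only [Set.mem_ofPred_eq, Set.mem_univ, iff_true]
      intro x hx
      have : x = 0 := by
        by_contra h0
        exact hno x h0 hx
      rw [this]
      exact dot_zero q
    have := tendsto_H hp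
    rwa [huniv, nhdsWithin_univ] at this
  · rintro ⟨x, hx0, hx⟩ hcont
    -- Moving `p` in the direction of the relation `x` breaks that relation, so slopes that lose a
    -- relation accumulate at `p` and the strict lower limit excludes continuity.
    set v : EuclideanSpace ℝ (Fin d) := WithLp.toLp 2 fun i => (x i : ℝ) with hv
    have hvx : 0 < dot v x := by
      obtain ⟨i, hi⟩ := Function.ne_iff.1 hx0
      refine Finset.sum_pos' (fun j _ => mul_self_nonneg _) ⟨i, Finset.mem_univ i, ?_⟩
      exact mul_self_pos.2 (Int.cast_ne_zero.2 hi)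
    have hne : (𝓝[{q | ¬ Lam p ⊆ Lam q}] p).NeBot := by
      rw [← mem_closure_iff_nhdsWithin_neBot]
      have hlim : Tendsto (fun t : ℝ => p + t • v) (𝓝[>] 0) (𝓝 p) := by
        have : Continuous fun t : ℝ => p + t • v := by fun_prop
        have h0 := this.tendsto 0
        rw [zero_smul, add_zero] at h0
        exact tendsto_nhdsWithin_of_tendsto_nhds h0
      refine mem_closure_of_tendsto hlim ?_
      filter_upwards [self_mem_nhdsWithin] with t ht hsub
      have h1 : dot (p + t • v) x = 0 := hsub hx
      have h2 : dot (p + t • v) x = dot p x + t * dot v x := by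
        simp only [dot, Finset.mul_sum, ← Finset.sum_add_distrib]
        exact Finset.sum_congr rfl fun i _ => by simp; ring
      rw [h2, show dot p x = 0 from hx, zero_add] at h1
      exact (mul_pos ht hvx).ne' h1
    have h1 : Tendsto (fun q : EuclideanSpace ℝ (Fin d) => ((H q : ℝ) : EReal))
        (𝓝[{q | ¬ Lam p ⊆ Lam q}] p) (𝓝 ((H p : ℝ) : EReal)) :=
      (continuous_coe_real_ereal.tendsto _).comp (tendsto_nhdsWithin_of_tendsto_nhds hcont)
    have h2 := lt_liminf_H hp
    rw [h1.liminf_eq] at h2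
    exact lt_irrefl _ h2

end

/-! ### The generic value -/

/-- Meant for `∑ φ^n / n` with `φ = charFn`, which is not summable where `|φ| = 1`. -/
lemma ae_summable_and_integrable_tsum {α : Type*} [MeasurableSpace α] {μ : Measure α}
    {F : ℕ → α → ℝ} (hF : ∀ n, Integrable (F n) μ)
    (hsum : Summable fun n => ∫ a, ‖F n a‖ ∂μ) :
    (∀ᵐ a ∂μ, Summable fun n => F n a) ∧ Integrable (fun a => ∑' n, F n a) μ := by
  have hfin : ∫⁻ a, ∑' n, ‖F n a‖ₑ ∂μ ≠ ⊤ := by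
    rw [lintegral_tsum fun n => (hF n).1.enorm]
    have h1 : ∀ n, ∫⁻ a, ‖F n a‖ₑ ∂μ = ENNReal.ofReal (∫ a, ‖F n a‖ ∂μ) := fun n => by
      rw [ofReal_integral_norm_eq_lintegral_enorm (hF n)]
    simp only [h1]
    exact hsum.tsum_ofReal_ne_top
  have hae : ∀ᵐ a ∂μ, Summable fun n => F n a := by
    filter_upwards [ae_lt_top' (AEMeasurable.tsum fun n => (hF n).1.enorm) hfin] with a ha
    refine Summable.of_norm ?_
    have : Summable fun n => ‖F n a‖₊ := ENNReal.tsum_coe_ne_top_iff_summable.1 ha.ne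
    exact NNReal.summable_coe.2 this
  refine ⟨hae, ?_, ?_⟩
  · refine aestronglyMeasurable_of_tendsto_ae atTop
      (f := fun N a => ∑ n ∈ Finset.range N, F n a)
      (fun N => (integrable_finsetSum _ fun n _ => hF n).1) ?_
    filter_upwards [hae] with a ha
    exact ha.hasSum.tendsto_sum_nat
  · refine lt_of_le_of_lt (lintegral_mono fun a => ?_) hfin.lt_top
    exact enorm_tsum_le_tsum_enorm

section
variable {d : ℕ}

/-- The characteristic function of the simple random walk. -/
def charFn (θ : Fin d → ℝ) : ℝ := (1 / (d : ℝ)) * ∑ k, Real.cos (θ k)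

/-- The character of the lattice with frequency `θ`. -/
def character (θ : Fin d → ℝ) : Multiplicative (Fin d → ℤ) →* ℂ where
  toFun x := ∏ k, Complex.exp (Complex.I * (x.toAdd k : ℂ) * (θ k : ℂ))
  map_one' := by simp
  map_mul' x y := by
    rw [← Finset.prod_mul_distrib]
    refine Finset.prod_congr rfl fun k _ => ?_
    rw [← Complex.exp_add]
    congr 1
    simp only [toAdd_mul, Pi.add_apply]
    push_cast
    ring

lemma character_single (θ : Fin d → ℝ) (i : Fin d) (n : ℤ) :
    character θ (Multiplicative.ofAdd (Pi.single i n)) = Complex.exp (Complex.I * n * θ i) := by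
  simp only [character, MonoidHom.coe_mk, OneHom.coe_mk, toAdd_ofAdd]
  rw [Finset.prod_eq_single i]
  · simp
  · intro j _ hj; simp [hj]
  · simp

lemma lift_character_latticeStep (θ : Fin d → ℝ) :
    AddMonoidAlgebra.lift ℝ ℂ (Fin d → ℤ) (character θ) (latticeStep d) = (charFn θ : ℂ) := by
  simp only [latticeStep, map_sum, map_add, AddMonoidAlgebra.lift_single, ← Pi.single_neg,
    character_single, charFn]
  push_cast
  rw [Finset.mul_sum]
  refine Finset.sum_congr rfl fun i _ => ?_
  rw [Complex.cos, ← smul_add, Complex.real_smul]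
  push_cast
  have h1 : Complex.I * 1 * (θ i : ℂ) = θ i * Complex.I := by ring
  have h2 : Complex.I * (-1) * (θ i : ℂ) = -(θ i : ℂ) * Complex.I := by ring
  rw [h1, h2]
  by_cases hd : (d : ℂ) = 0
  · simp [hd]
  · field_simp

/-- A character extends to an algebra homomorphism on the group algebra, so convolution powers
become powers. -/
lemma charFn_pow_eq_sum (θ : Fin d → ℝ) (n : ℕ) :
    ((charFn θ : ℝ) : ℂ) ^ n = ∑ x ∈ (latticeStep d ^ n).coeff.support,
      (walkProb n x : ℂ) * ∏ k, Complex.exp (Complex.I * (x k : ℂ) * (θ k : ℂ)) := by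
  rw [← lift_character_latticeStep, ← map_pow, AddMonoidAlgebra.lift_apply, Finsupp.sum]
  refine Finset.sum_congr rfl fun x _ => ?_
  rw [Complex.real_smul]
  rfl

/-! ### Fourier inversion on the cell and the integral of `S`. -/

lemma restrict_cell : (volume : Measure (Fin d → ℝ)).restrict (cell d)
    = Measure.pi fun _ => (volume : Measure ℝ).restrict (Set.Icc (-Real.pi) Real.pi) := by
  rw [cell, ← Set.pi_univ_Icc, volume_pi, Measure.restrict_pi_pi]

instance : IsFiniteMeasure ((volume : Measure (Fin d → ℝ)).restrict (cell d)) := by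
  rw [restrict_cell]
  infer_instance

lemma integral_exp_int_mul (n : ℤ) : ∫ t in Set.Icc (-Real.pi) Real.pi,
    Complex.exp (Complex.I * (n : ℂ) * (t : ℂ)) = if n = 0 then (2 * Real.pi : ℂ) else 0 := by
  rw [integral_Icc_eq_integral_Ioc, ← intervalIntegral.integral_of_le
    (by linarith [Real.pi_pos])]
  split_ifs with h
  · subst h
    simp
    ring
  · have hc : Complex.I * (n : ℂ) ≠ 0 := mul_ne_zero Complex.I_ne_zero (Int.cast_ne_zero.2 h)
    rw [integral_exp_mul_complex hc]
    have : Complex.exp (Complex.I * n * (Real.pi : ℝ))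
        = Complex.exp (Complex.I * n * ((-Real.pi : ℝ) : ℂ)) := by
      rw [Complex.exp_eq_exp_iff_exists_int]
      exact ⟨n, by push_cast; ring⟩
    rw [this, sub_self, zero_div]

lemma integral_character (x : Fin d → ℤ) :
    ∫ θ in cell d, ∏ k, Complex.exp (Complex.I * (x k : ℂ) * (θ k : ℂ))
      = if x = 0 then (2 * Real.pi : ℂ) ^ d else 0 := by
  rw [restrict_cell, integral_fintype_prod_eq_prod
    (f := fun k (t : ℝ) => Complex.exp (Complex.I * (x k : ℂ) * (t : ℂ)))]
  simp only [integral_exp_int_mul]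
  split_ifs with h
  · subst h
    simp
  · obtain ⟨i, hi⟩ := Function.ne_iff.1 h
    exact Finset.prod_eq_zero (Finset.mem_univ i) (if_neg hi)

lemma continuous_charFn : Continuous (charFn (d := d)) := by
  unfold charFn
  fun_prop

lemma abs_charFn_le (θ : Fin d → ℝ) : |charFn θ| ≤ 1 := by
  rw [charFn, abs_mul, abs_of_nonneg (by positivity)]
  rcases d.eq_zero_or_pos with rfl | hd
  · simp
  have hd' : (0 : ℝ) < d := by exact_mod_cast hd
  have : |∑ k, Real.cos (θ k)| ≤ d := by
    refine (Finset.abs_sum_le_sum_abs _ _).trans ?_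
    refine (Finset.sum_le_card_nsmul _ _ 1 fun k _ => Real.abs_cos_le_one _).trans ?_
    simp
  calc 1 / (d : ℝ) * |∑ k, Real.cos (θ k)| ≤ 1 / d * d := by gcongr
    _ = 1 := by field_simp

lemma integrable_cell_of_continuous {E : Type*} [NormedAddCommGroup E] {f : (Fin d → ℝ) → E}
    (hf : Continuous f) : Integrable f ((volume : Measure (Fin d → ℝ)).restrict (cell d)) :=
  hf.continuousOn.integrableOn_compact isCompact_Icc

lemma integral_charFn_pow (n : ℕ) :
    ∫ θ in cell d, charFn θ ^ n = (2 * Real.pi) ^ d * walkProb n (0 : Fin d → ℤ) := by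
  have h : ∫ θ in cell d, ((charFn θ ^ n : ℝ) : ℂ)
      = (((2 * Real.pi) ^ d * walkProb n (0 : Fin d → ℤ) : ℝ) : ℂ) := by
    push_cast
    simp only [charFn_pow_eq_sum]
    rw [integral_finsetSum _ fun x _ => integrable_cell_of_continuous (by fun_prop)]
    simp only [integral_const_mul, integral_character, mul_ite, mul_zero]
    rw [Finset.sum_ite_eq', mul_comm]
    split_ifs with h0
    · rfl
    · rw [walkProb, Finsupp.notMem_support_iff.1 h0]
      simp
  rw [integral_complex_ofReal] at h
  exact_mod_cast h

lemma walkProb_zero_le_returnProb (p : EuclideanSpace ℝ (Fin d)) (n : ℕ) :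
    walkProb n (0 : Fin d → ℤ) ≤ returnProb p n := by
  rw [returnProb_eq_sum]
  have hnn : ∀ x, 0 ≤ if dot p x = 0 then walkProb n x else 0 := fun x => by
    split_ifs
    · exact walkProb_nonneg n x
    · exact le_rfl
  by_cases h : (0 : Fin d → ℤ) ∈ (latticeStep d ^ n).coeff.support
  · refine le_trans ?_ (Finset.single_le_sum (fun x _ => hnn x) h)
    rw [if_pos (dot_zero p)]
  · rw [walkProb, Finsupp.notMem_support_iff.1 h]
    exact Finset.sum_nonneg fun x _ => hnn x

/-- A return of the lattice walk is a return of its projection along any slope, here a unit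
coordinate vector. -/
lemma walkProb_zero_le (hd : 0 < d) (n : ℕ) :
    walkProb n (0 : Fin d → ℤ) ≤ d / Real.sqrt (n + 1) := by
  have hp : (EuclideanSpace.single ⟨0, hd⟩ 1 : EuclideanSpace ℝ (Fin d)) ≠ 0 := by
    simp
  exact (walkProb_zero_le_returnProb _ n).trans (returnProb_le hp n)

lemma integral_abs_charFn_pow_le (hd : 0 < d) {n : ℕ} (hn : n ≠ 0) :
    ∫ θ in cell d, |charFn θ| ^ n ≤ (2 * Real.pi) ^ d * (d / Real.sqrt n) := by
  have hpi := Real.pi_pos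
  obtain ⟨m, hm⟩ : ∃ m, n = 2 * m ∨ n = 2 * m + 1 := Nat.even_or_odd' n
  -- Since `|charFn| ≤ 1`, an odd power is dominated by the preceding even one, whose integral is a
  -- return probability up to the volume of the cell.
  have hle : ∫ θ in cell d, |charFn θ| ^ n ≤ ∫ θ in cell d, charFn θ ^ (2 * m) := by
    refine integral_mono (integrable_cell_of_continuous (continuous_charFn.abs.pow n))
      (integrable_cell_of_continuous (continuous_charFn.pow _)) fun θ => ?_
    have h1 : charFn θ ^ (2 * m) = |charFn θ| ^ (2 * m) := by
      rw [pow_mul, pow_mul, sq_abs]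
    dsimp only
    rw [h1]
    exact pow_le_pow_of_le_one (abs_nonneg _) (abs_charFn_le θ) (by omega)
  refine hle.trans ?_
  rw [integral_charFn_pow]
  refine mul_le_mul_of_nonneg_left ((walkProb_zero_le hd _).trans ?_) (by positivity)
  have hn' : (0 : ℝ) < n := by exact_mod_cast Nat.pos_of_ne_zero hn
  have : (n : ℝ) ≤ ((2 * m : ℕ) : ℝ) + 1 := by exact_mod_cast (by omega : n ≤ 2 * m + 1)
  gcongr

lemma summable_integral_charFn_pow (hd : 0 < d) :
    Summable fun n : ℕ => ∫ θ in cell d, ‖charFn θ ^ n / n‖ := by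
  refine Summable.of_nonneg_of_le (fun n => integral_nonneg fun _ => norm_nonneg _) (fun n => ?_)
    ((summable_returnMajorant d).mul_left ((2 * Real.pi) ^ d))
  rcases Nat.eq_zero_or_pos n with rfl | hn
  · simp [returnMajorant]
  have hn' : (0 : ℝ) < n := by exact_mod_cast hn
  have h1 : ∀ θ : Fin d → ℝ, ‖charFn θ ^ n / n‖ = |charFn θ| ^ n / n := fun θ => by
    rw [norm_div, norm_pow, Real.norm_eq_abs, Real.norm_natCast]
  simp only [h1]
  rw [integral_div]
  have h2 : (n : ℝ) ^ (3 / 2 : ℝ) = Real.sqrt n * n := by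
    rw [Real.sqrt_eq_rpow, show (3 / 2 : ℝ) = 1 / 2 + 1 by norm_num, Real.rpow_add hn',
      Real.rpow_one]
  calc (∫ θ in cell d, |charFn θ| ^ n) / n ≤ (2 * Real.pi) ^ d * (d / Real.sqrt n) / n := by
        gcongr
        exact integral_abs_charFn_pow_le hd hn.ne'
    _ = (2 * Real.pi) ^ d * returnMajorant d n := by
        rw [returnMajorant, h2]
        field_simp

/-- Summability itself forces `|c| < 1`, by comparison with the harmonic series, so the exceptional
frequencies need no description. -/
lemma tsum_charFn_eq {c : ℝ} (hs : Summable fun n : ℕ => c ^ n / n) :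
    ∑' n : ℕ, c ^ n / n = -Real.log (1 - c) := by
  have hc : |c| < 1 := by
    by_contra h
    push Not at h
    refine Real.not_summable_one_div_natCast (Summable.of_nonneg_of_le (fun n => by positivity)
      (fun n => ?_) hs.abs)
    rw [abs_div, abs_pow, Nat.abs_cast]
    gcongr
    exact one_le_pow₀ h
  rw [hs.tsum_eq_zero_add, ← (Real.hasSum_pow_div_log_of_abs_lt_one hc).tsum_eq]
  simp

lemma S_integrable_and_integral :
    IntegrableOn (S (d := d)) (cell d) ∧ (0 < d → ∫ θ in cell d, S θ
      = -((2 * Real.pi) ^ d * ∑' n : ℕ, walkProb n (0 : Fin d → ℤ) / n)) := by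
  rcases d.eq_zero_or_pos with rfl | hd
  · refine ⟨?_, fun h => absurd h (lt_irrefl _)⟩
    -- For `d = 0` the sum is empty and `S` is `log 1`.
    have : (S : (Fin 0 → ℝ) → ℝ) = fun _ => 0 := by
      ext θ
      simp [S]
    rw [this]
    exact integrableOn_zero
  have hint : ∀ n : ℕ, Integrable (fun θ : Fin d → ℝ => charFn θ ^ n / n)
      (volume.restrict (cell d)) := fun n =>
    integrable_cell_of_continuous ((continuous_charFn.pow n).div_const _)
  have hsum := summable_integral_charFn_pow hd
  obtain ⟨hae, hI⟩ := ae_summable_and_integrable_tsum hint hsum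
  have heq : (fun θ : Fin d → ℝ => -∑' n : ℕ, charFn θ ^ n / n) =ᵐ[volume.restrict (cell d)]
      S := by
    filter_upwards [hae] with θ hθ
    rw [tsum_charFn_eq hθ, neg_neg]
    rfl
  refine ⟨hI.neg.congr heq, fun _ => ?_⟩
  rw [← integral_congr_ae heq, integral_neg, ← integral_tsum_of_summable_integral_norm hint hsum,
    ← tsum_mul_left]
  congr 1
  refine tsum_congr fun n => ?_
  rw [integral_div, integral_charFn_pow, mul_div_assoc]

lemma Shat_zero (hd : 0 < d) :
    Shat (0 : Fin d → ℤ) = ((-∑' n : ℕ, walkProb n (0 : Fin d → ℤ) / n : ℝ) : ℂ) := by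
  have h1 : ∀ θ : Fin d → ℝ, Complex.exp (-Complex.I * ∑ k, (((0 : Fin d → ℤ) k : ℤ) : ℂ)
      * (θ k : ℂ)) * (S θ : ℂ) = ((S θ : ℝ) : ℂ) := fun θ => by simp
  rw [Shat]
  simp only [h1]
  rw [integral_complex_ofReal, S_integrable_and_integral.2 hd]
  have hpi : (2 * (Real.pi : ℂ)) ^ d ≠ 0 :=
    pow_ne_zero _ (mul_ne_zero two_ne_zero (Complex.ofReal_ne_zero.2 Real.pi_ne_zero))
  push_cast
  field_simp

/-! ### Slopes without relations, and their full measure on the sphere. -/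

lemma returnProb_eq_walkProb {p : EuclideanSpace ℝ (Fin d)} (h : ∀ x, x ≠ 0 → dot p x ≠ 0)
    (n : ℕ) : returnProb p n = walkProb n (0 : Fin d → ℤ) := by
  refine le_antisymm ?_ (walkProb_zero_le_returnProb p n)
  rw [returnProb_eq_sum]
  have e : ∀ x ∈ (latticeStep d ^ n).coeff.support, (if dot p x = 0 then walkProb n x else 0)
      = if x = 0 then walkProb n x else 0 := fun x _ => by
    by_cases hx : x = 0
    · rw [if_pos hx, if_pos (by rw [hx, dot_zero])]
    · rw [if_neg hx, if_neg (h x hx)]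
  rw [Finset.sum_congr rfl e, Finset.sum_ite_eq']
  split_ifs
  · exact le_rfl
  · exact walkProb_nonneg n 0

theorem H_sq_of_no_relation {p : EuclideanSpace ℝ (Fin d)} (hp : ‖p‖ = 1)
    (h : ∀ x, x ≠ 0 → dot p x ≠ 0) :
    ((H p : ℝ) : ℂ) ^ 2 = 2 * (d : ℂ) * Complex.exp (Shat (0 : Fin d → ℤ)) := by
  have hp0 : p ≠ 0 := by
    rintro rfl
    simp at hp
  have e : returnSum p = ∑' n : ℕ, walkProb n (0 : Fin d → ℤ) / n :=
    tsum_congr fun n => by rw [returnProb_eq_walkProb h]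
  have h2 : H p ^ 2 = 2 * d * Real.exp (-returnSum p) := by
    rw [H_eq_exp hp0, hp, one_mul, mul_pow, Real.sq_sqrt (by positivity), ← Real.exp_nat_mul]
    congr 2
    push_cast
    ring
  rw [Shat_zero (dim_pos hp0), ← e]
  exact_mod_cast h2

/-- The set is the unit sphere of a space `W` of dimension `d - 1`. There the Hausdorff measure is
proportional to Lebesgue measure, for which spheres of nonzero radius are null. -/
lemma hausdorffMeasure_sphere_inter_hyperplane {x : Fin d → ℤ} (hx : x ≠ 0) :
    (Measure.hausdorffMeasure ((d : ℝ) - 1) : Measure (EuclideanSpace ℝ (Fin d)))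
      ({p | dot p x = 0} ∩ Metric.sphere 0 1) = 0 := by
  set E := EuclideanSpace ℝ (Fin d)
  set v : E := WithLp.toLp 2 fun i => (x i : ℝ) with hv
  have hv0 : v ≠ 0 := by
    obtain ⟨i, hi⟩ := Function.ne_iff.1 hx
    intro h
    have : v i = 0 := by rw [h]; rfl
    exact Int.cast_ne_zero.2 hi this
  set W : Submodule ℝ E := (Submodule.span ℝ {v})ᗮ with hW
  have hd : 0 < d := dim_pos hv0
  have hrank : Module.finrank ℝ W + 1 = d := by
    have h1 := Submodule.finrank_add_finrank_orthogonal (Submodule.span ℝ {v})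
    rw [finrank_span_singleton hv0, finrank_euclideanSpace_fin, ← hW] at h1
    omega
  have hset : {p : E | dot p x = 0} ∩ Metric.sphere 0 1
      = W.subtypeₗᵢ '' Metric.sphere 0 1 := by
    ext p
    have hmem : p ∈ W ↔ dot p x = 0 := by
      rw [hW, Submodule.mem_orthogonal_singleton_iff_inner_right, PiLp.inner_apply]
      simp [dot, hv]
    constructor
    · rintro ⟨h1, h2⟩
      exact ⟨⟨p, hmem.2 h1⟩, by simpa using h2, rfl⟩
    · rintro ⟨⟨q, hq⟩, h1, rfl⟩
      exact ⟨hmem.1 hq, by simpa using h1⟩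
  have hdim : (d : ℝ) - 1 = (Module.finrank ℝ W : ℝ) := by
    have : ((Module.finrank ℝ W + 1 : ℕ) : ℝ) = d := by rw [hrank]
    push_cast at this
    linarith
  rw [hset, hdim, W.subtypeₗᵢ.isometry.hausdorffMeasure_image (Or.inl (Nat.cast_nonneg _))]
  have hvol : (volume : Measure W) (Metric.sphere 0 1) = 0 :=
    Measure.addHaar_sphere_of_ne_zero _ _ one_ne_zero
  rw [← InnerProductSpace.euclideanHausdorffMeasure_eq_volume,
    Measure.euclideanHausdorffMeasure_def, Measure.smul_apply, ENNReal.smul_def, smul_eq_mul,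
    mul_eq_zero] at hvol
  refine hvol.resolve_left ?_
  exact_mod_cast Measure.addHaarScalarFactor_volume_hausdorffMeasure_ne_zero _

theorem ae_no_relation : ∀ᵐ p ∂((Measure.hausdorffMeasure ((d : ℝ) - 1) :
    Measure (EuclideanSpace ℝ (Fin d))).restrict (Metric.sphere 0 1)),
    ‖p‖ = 1 ∧ ∀ x : Fin d → ℤ, x ≠ 0 → dot p x ≠ 0 := by
  have h1 : ∀ᵐ p ∂((Measure.hausdorffMeasure ((d : ℝ) - 1) :
      Measure (EuclideanSpace ℝ (Fin d))).restrict (Metric.sphere 0 1)), ‖p‖ = 1 := by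
    filter_upwards [ae_restrict_mem Metric.isClosed_sphere.measurableSet] with p hp
    simpa using hp
  refine h1.and (ae_all_iff.2 fun x => ?_)
  by_cases hx : x = 0
  · exact Eventually.of_forall fun p h => absurd hx h
  have hmeas : MeasurableSet {p : EuclideanSpace ℝ (Fin d) | dot p x = 0} :=
    (isClosed_eq (continuous_dot x) continuous_const).measurableSet
  have h2 := hausdorffMeasure_sphere_inter_hyperplane hx
  rw [← Measure.restrict_apply hmeas] at h2
  filter_upwards [compl_mem_ae_iff.2 h2] with p hp _
  exact hp

end

end

end LatticeHamiltonian

theorem theoremt (d : ℕ) :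
    -- the Hamiltonian is well defined: the half-space problem is uniquely solvable
    (∀ p : EuclideanSpace ℝ (Fin d), p ≠ 0 →
      ∃! u : (Fin d → ℤ) → ℝ, LatticeHamiltonian.IsHalfSpaceSolution p u) ∧
    -- the two limits at a slope
    (∀ p : EuclideanSpace ℝ (Fin d), p ≠ 0 →
      Tendsto (LatticeHamiltonian.H (d := d))
        (𝓝[{q | LatticeHamiltonian.Lam p ⊆ LatticeHamiltonian.Lam q}] p)
        (𝓝 (LatticeHamiltonian.H p)) ∧
      ((LatticeHamiltonian.H p : ℝ) : EReal) <
        liminf (fun q : EuclideanSpace ℝ (Fin d) => ((LatticeHamiltonian.H q : ℝ) : EReal))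
          (𝓝[{q | ¬ LatticeHamiltonian.Lam p ⊆ LatticeHamiltonian.Lam q}] p)) ∧
    -- the generic value on the unit sphere
    (IntegrableOn (LatticeHamiltonian.S (d := d)) (LatticeHamiltonian.cell d) ∧
      ∀ᵐ p ∂((Measure.hausdorffMeasure ((d : ℝ) - 1) :
          Measure (EuclideanSpace ℝ (Fin d))).restrict (Metric.sphere 0 1)),
        ((LatticeHamiltonian.H p : ℝ) : ℂ) ^ 2 =
          2 * (d : ℂ) * Complex.exp (LatticeHamiltonian.Shat (0 : Fin d → ℤ))) ∧
    -- discontinuity exactly at slopes with a nontrivial Diophantine relation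
    (∀ p : EuclideanSpace ℝ (Fin d), p ≠ 0 →
      (¬ ContinuousAt (LatticeHamiltonian.H (d := d)) p ↔
        ∃ x : Fin d → ℤ, x ≠ 0 ∧ x ∈ LatticeHamiltonian.Lam p)) := by
  refine ⟨fun p hp => LatticeHamiltonian.existsUnique_isHalfSpaceSolution hp,
    fun p hp => ⟨LatticeHamiltonian.tendsto_H hp, LatticeHamiltonian.lt_liminf_H hp⟩,
    ⟨LatticeHamiltonian.S_integrable_and_integral.1, ?_⟩,
    fun p hp => LatticeHamiltonian.not_continuousAt_H_iff hp⟩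
  filter_upwards [LatticeHamiltonian.ae_no_relation] with p hp
  exact LatticeHamiltonian.H_sq_of_no_relation hp.1 hp.2
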